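/- Let $a,b>-1$ be real, let $\{\varphi_j\}_{j\ge 0}$ be the sequence obtained by orthonormalizing (Gram–Schmidt) the sequence $\{x^j(1-x)^{a/2}(1+x)^{b/2}\}_{j\ge 0}$ in $L^2[-1,1]$, and let $$K_N^{(2)}(x,y)=\sum_{j=0}^{N-1}\varphi_j(x)\varphi_j(y).$$ Let $J_\nu(x)=\sum_{k\ge 0}\frac{(-1)^k}{k!\,\Gamma(k+\nu+1)}\left(\frac{x}{2}\right)^{2k+\nu}$ ($x>0$, with $1/\Gamma=0$ at the poles of $\Gamma$) be the Bessel function of the first kind of order $\nu$, and for $x,y>0$ let the Bessel kernel of order $a$ be $$K_{\mathrm{Bessel}}^{(a)}(x,y)=\frac{J_a(\sqrt{x})\sqrt{y}\,J_a'(\sqrt{y})-J_a'(\sqrt{x})\sqrt{x}\,J_a(\sqrt{y})}{2(x-y)}\quad (x\ne y),$$ with the value on the diagonal given by the limit $y\to x$, $$K_{\mathrm{Bessel}}^{(a)}(x,x)=\frac{J_a(\sqrt{x})^2-J_{a+1}(\sqrt{x})J_{a-1}(\sqrt{x})}{4}.$$ Then, as $N\to\infty$, $$\frac{1}{2N^2}K_N^{(2)}\left(1-\frac{x}{2N^2},1-\frac{y}{2N^2}\right)=K_{\mathrm{Bessel}}^{(a)}(x,y)+O(N^{-1}),$$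 uniformly for $x$ and $y$ in compact subsets of $\mathbb{R}^+=(0,\infty)$. That is, for every compact $K\subset(0,\infty)$ there are a constant $C$ and an $N_0$, depending only on $a$, $b$ and $K$, such that for all $N\ge N_0$ and all $x,y\in K$ the two sides without the error term differ by at most $C/N$. -/

import Mathlib

namespace JUE

/-- The function `x ↦ x ^ j * (1 - x) ^ (a / 2) * (1 + x) ^ (b / 2)`, to be considered on
`[-1, 1]`. -/
noncomputable def weightedMonomial (a b : ℝ) (j : ℕ) (x : ℝ) : ℝ :=
  x ^ j * (1 - x) ^ (a / 2) * (1 + x) ^ (b / 2)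

/-- The inner product `∫_{-1}^{1} f(x) g(x) dx` of the real space `L²[-1, 1]`, on functions. -/
noncomputable def innerProd (f g : ℝ → ℝ) : ℝ :=
  ∫ x in (-1 : ℝ)..1, f x * g x

/-- The orthogonal (not yet normalized) functions that the Gram–Schmidt process in `L²[-1, 1]`
makes out of the weighted monomials of index `0, 1, 2, …`. -/
noncomputable def orthogonalFun (a b : ℝ) (n : ℕ) : ℝ → ℝ := fun x =>
  weightedMonomial a b n x -
    ∑ k : Fin n,
      innerProd (orthogonalFun a b k) (weightedMonomial a b n) /
        innerProd (orthogonalFun a b k) (orthogonalFun a b k) * orthogonalFun a b k x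
termination_by n
decreasing_by all_goals exact k.2

/-- The orthonormal functions `φ_j` obtained by orthonormalizing the weighted monomials in
`L²[-1, 1]`. -/
noncomputable def phi (a b : ℝ) (j : ℕ) (x : ℝ) : ℝ :=
  orthogonalFun a b j x / √(innerProd (orthogonalFun a b j) (orthogonalFun a b j))

/-- The kernel `K_N(x, y) = ∑_{j = 0}^{N - 1} φ_j(x) φ_j(y)` of the Jacobi unitary ensemble. -/
noncomputable def kernel (a b : ℝ) (N : ℕ) (x y : ℝ) : ℝ :=
  ∑ j ∈ Finset.range N, phi a b j x * phi a b j y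

/-- The Bessel function of the first kind of real order `ν`, for `x > 0`:
`J_ν(x) = ∑_{k ≥ 0} (-1)^k / (k! Γ(k + ν + 1)) (x / 2)^(2 k + ν)`.
Mathlib's `Gamma` is `0` at the poles of the Gamma function, so that the quotient is `0` there,
which is the usual convention `1 / Γ = 0`. -/
noncomputable def besselJ (ν x : ℝ) : ℝ :=
  ∑' k : ℕ, (-1 : ℝ) ^ k / ((k.factorial : ℝ) * Real.Gamma (k + ν + 1)) *
    (x / 2) ^ (2 * (k : ℝ) + ν)

open Classical in
/-- The Bessel kernel of order `a` at `x, y > 0`. On the diagonal, where the quotient is not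
defined, it is the limit of the quotient as `y → x`. -/
noncomputable def besselKernel (a x y : ℝ) : ℝ :=
  if x = y then
    (besselJ a √x ^ 2 - besselJ (a + 1) √x * besselJ (a - 1) √x) / 4
  else
    (besselJ a √x * √y * deriv (besselJ a) √y - deriv (besselJ a) √x * √x * besselJ a √y) /
      (2 * (x - y))

end JUE

namespace JUE

open Set Filter Topology intervalIntegral Asymptotics

/-! Write `f = besselEntire a`, so that `J_a(√z) = (√z / 2) ^ a * f z`. Lommel's integrals turn the
Bessel kernel, off and on the diagonal, into `(√x / 2) ^ a * (√y / 2) ^ a / 4` times `∫ t in 0..1, t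
^ a * f (x t) * f (y t)` (`besselKernel_eq_integral`). The finite kernel is a discrete version of
this integral.

In the variable `u = (1 - x) / 2`, Gram–Schmidt yields multiples of the Jacobi polynomials `Q_j`
with `Q_j(0) = 1`. Apart from the weights, the kernel is thus `∑ Q_j(u) Q_j(v) / h_j`, with `h_j`
the squared norm (`kernel_eq_sum_jacobiPoly`). Two facts about the eigenvalues `λ_j = j (j + a + b +
1)` give the limit: - The coefficients of `Q_j` depend on `j` only through products of the
differences `λ_j - λ_i`. Replacing these products by powers of `λ_j` gives `Q_j(x / 4N²) = Γ(a+1)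
f(x λ_j / N²) + O(N⁻²)`, uniformly in `j ≤ N` (`exists_abs_jacobiPoly_sub_besselEntire_le`). - The
partial sums of `1 / h_j` are explicit Gamma quotients, equal to `λ_n ^ (a+1) / (Γ(a+1) Γ(a+2))` up
to a relative error `O(1/n)`. With nodes `t_j = λ_j / N²`, the kernel sum is therefore nearly a
Stieltjes sum for the measure `d(t ^ (a+1))`. Summation by parts keeps the error at `O(1/N)`
(`exists_abs_sum_sub_integral_le`).

The remaining weight factors `(1 - x / 4N²) ^ (b/2)` are `1 + O(1/N)` on compact sets. -/

/-! ### Bessel functions through an entire series -/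

/-- The coefficients of the entire function `z ↦ (√z / 2) ^ (-a) * J_a(√z)`. -/
noncomputable def besselCoeff (a : ℝ) (k : ℕ) : ℝ :=
  (-1 / 4 : ℝ) ^ k / ((k.factorial : ℝ) * Real.Gamma (k + a + 1))

/-- The entire function `z ↦ (√z / 2) ^ (-a) * J_a(√z)`. -/
noncomputable def besselEntire (a z : ℝ) : ℝ := ∑' k : ℕ, besselCoeff a k * z ^ k

/-- From `k = 1` on, the functional equation multiplies by a factor at least `1`, so the values
increase. The index `0` is separate because the factor `a + 1` may be below `1`. -/
lemma exists_inv_Gamma_le {a : ℝ} (ha : -1 < a) :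
    ∃ C : ℝ, 0 < C ∧ ∀ k : ℕ, (Real.Gamma (k + a + 1))⁻¹ ≤ C := by
  have h1 : ∀ k : ℕ, 0 < Real.Gamma (k + a + 1) := fun k =>
    Real.Gamma_pos_of_pos (by have : (0 : ℝ) ≤ k := k.cast_nonneg; linarith)
  have h2 : ∀ k : ℕ, Real.Gamma ((1 : ℕ) + a + 1) ≤ Real.Gamma ((k + 1 : ℕ) + a + 1) := by
    intro k
    induction k with
    | zero => simp
    | succ k ih =>
      refine ih.trans ?_
      have hk : (0 : ℝ) ≤ k := k.cast_nonneg
      have e : (((k + 1 + 1 : ℕ) : ℝ) + a + 1) = ((k + 1 : ℕ) + a + 1) + 1 := by push_cast; ring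
      rw [e, Real.Gamma_add_one (by push_cast; linarith : (0 : ℝ) < (k + 1 : ℕ) + a + 1).ne']
      have := h1 (k + 1)
      refine le_mul_of_one_le_left this.le (by push_cast; linarith)
  refine ⟨(Real.Gamma ((0 : ℕ) + a + 1))⁻¹ + (Real.Gamma ((1 : ℕ) + a + 1))⁻¹,
    add_pos (inv_pos.2 (h1 0)) (inv_pos.2 (h1 1)), fun k => ?_⟩
  rcases k with _ | k
  · exact le_add_of_nonneg_right (inv_pos.2 (h1 1)).le
  · refine (inv_anti₀ (h1 1) (h2 k)).trans (le_add_of_nonneg_left (inv_pos.2 (h1 0)).le)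

lemma exists_abs_besselCoeff_le {a : ℝ} (ha : -1 < a) :
    ∃ C : ℝ, 0 < C ∧ ∀ k : ℕ, |besselCoeff a k| ≤ C * ((1 / 4) ^ k / k.factorial) := by
  obtain ⟨C, hC, h⟩ := exists_inv_Gamma_le ha
  refine ⟨C, hC, fun k => ?_⟩
  have hG : 0 < Real.Gamma (k + a + 1) :=
    Real.Gamma_pos_of_pos (by have : (0 : ℝ) ≤ k := k.cast_nonneg; linarith)
  have e : |besselCoeff a k| = (Real.Gamma (k + a + 1))⁻¹ * ((1 / 4) ^ k / k.factorial) := by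
    rw [besselCoeff, abs_div, abs_pow, abs_mul, abs_of_pos hG, Nat.abs_cast]
    norm_num
    field_simp
  rw [e]
  exact mul_le_mul_of_nonneg_right (h k) (by positivity)

lemma summable_besselCoeff_mul_pow {a : ℝ} (ha : -1 < a) (z : ℝ) :
    Summable fun k => besselCoeff a k * z ^ k := by
  obtain ⟨C, hC, h⟩ := exists_abs_besselCoeff_le ha
  refine Summable.of_norm_bounded
    ((Real.summable_pow_div_factorial (|z| / 4)).mul_left C) fun k => ?_
  rw [Real.norm_eq_abs, abs_mul, abs_pow]
  refine (mul_le_mul_of_nonneg_right (h k) (by positivity)).trans_eq ?_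
  rw [div_pow, div_pow, one_pow]
  ring

lemma besselCoeff_eq_mul (a : ℝ) (k : ℕ) :
    besselCoeff a k = (k + a + 1) * besselCoeff (a + 1) k := by
  unfold besselCoeff
  rcases eq_or_ne ((k : ℝ) + a + 1) 0 with h | h
  · rw [h]; simp [Real.Gamma_zero]
  · have e : (k : ℝ) + (a + 1) + 1 = (k + a + 1) + 1 := by ring
    rw [e, Real.Gamma_add_one h]
    field_simp

lemma succ_mul_besselCoeff_succ (a : ℝ) (k : ℕ) :
    (k + 1 : ℝ) * besselCoeff a (k + 1) = -1 / 4 * besselCoeff (a + 1) k := by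
  unfold besselCoeff
  have e : ((k + 1 : ℕ) : ℝ) + a + 1 = k + (a + 1) + 1 := by push_cast; ring
  rw [e, Nat.factorial_succ, pow_succ]
  have : (k + 1 : ℝ) ≠ 0 := by positivity
  push_cast
  field_simp

lemma hasSum_besselEntire {a : ℝ} (ha : -1 < a) (z : ℝ) :
    HasSum (fun k => besselCoeff a k * z ^ k) (besselEntire a z) :=
  (summable_besselCoeff_mul_pow ha z).hasSum

/-- This is `J_ν + J_{ν+2} = (2 (ν+1) / r) J_{ν+1}`. The diagonal of the kernel involves order `a -
1`, which may lie below `-1`; hence the range `-2 < a`, and a proof that sums only the series of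
orders `a + 1` and `a + 2`. -/
lemma besselEntire_contiguous {a : ℝ} (ha : -2 < a) (z : ℝ) :
    besselEntire a z = (a + 1) * besselEntire (a + 1) z - z / 4 * besselEntire (a + 2) z := by
  have h1 := (hasSum_besselEntire (by linarith : -1 < a + 1) z).mul_left (a + 1)
  have h2 := (hasSum_besselEntire (by linarith : -1 < a + 2) z).mul_left (-(z / 4))
  have h3 : HasSum (fun k : ℕ => k * besselCoeff (a + 1) k * z ^ k)
      (-(z / 4) * besselEntire (a + 2) z) := by
    refine (hasSum_nat_add_iff' 1).1 ?_
    simp only [Finset.range_one, Finset.sum_singleton, Nat.cast_zero, zero_mul, sub_zero]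
    refine h2.congr_fun ?_
    intro k
    have := succ_mul_besselCoeff_succ (a + 1) k
    rw [show a + 1 + 1 = a + 2 by ring] at this
    push_cast
    rw [this, pow_succ]
    ring
  have h4 := h1.add h3
  rw [besselEntire]
  rw [show (a + 1) * besselEntire (a + 1) z - z / 4 * besselEntire (a + 2) z =
    (a + 1) * besselEntire (a + 1) z + -(z / 4) * besselEntire (a + 2) z by ring, ← h4.tsum_eq]
  refine tsum_congr fun k => ?_
  rw [besselCoeff_eq_mul]
  ring

lemma hasDerivAt_besselEntire {a : ℝ} (ha : -1 < a) (z : ℝ) :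
    HasDerivAt (besselEntire a) (-1 / 4 * besselEntire (a + 1) z) z := by
  obtain ⟨C, hC, h⟩ := exists_abs_besselCoeff_le ha
  set R := |z| + 1
  have hR : 0 < R := by positivity
  have hu : Summable fun k : ℕ => C * ((2 * R / 4) ^ k / k.factorial) * R⁻¹ :=
    ((Real.summable_pow_div_factorial (2 * R / 4)).mul_left C).mul_right _
  have key := hasDerivAt_tsum_of_isPreconnected (g := fun k z => besselCoeff a k * z ^ k)
    (g' := fun k z => besselCoeff a k * (k * z ^ (k - 1))) (t := Metric.ball (0 : ℝ) R)
    (y₀ := z) (y := z) hu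
    Metric.isOpen_ball (convex_ball _ _).isPreconnected
    (fun k y _ => (hasDerivAt_pow k y).const_mul _) ?_ (by simp [R])
    (summable_besselCoeff_mul_pow ha z) (by simp [R])
  · refine key.congr_deriv ?_
    have h0 : HasSum (fun k : ℕ => besselCoeff a k * (k * z ^ (k - 1)))
        (-1 / 4 * besselEntire (a + 1) z) := by
      refine (hasSum_nat_add_iff' 1).1 ?_
      simp only [Finset.range_one, Finset.sum_singleton, Nat.cast_zero, zero_mul, mul_zero,
        sub_zero, Nat.add_sub_cancel]
      refine ((hasSum_besselEntire (by linarith : -1 < a + 1) z).mul_left (-1 / 4)).congr_fun ?_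
      intro k
      have := succ_mul_besselCoeff_succ a k
      push_cast
      linear_combination z ^ k * this
    exact h0.tsum_eq
  · intro k y hy
    have hy' : |y| ≤ R := by simpa using (mem_ball_zero_iff.1 hy).le
    rw [Real.norm_eq_abs, abs_mul, abs_mul, abs_pow, Nat.abs_cast]
    rcases k with _ | k
    · simp; positivity
    -- The factor `k + 1` from differentiation is absorbed in `2 ^ (k + 1)`; this is the `2` in the
    -- majorant `hu`.
    · have h2 : ((k + 1 : ℕ) : ℝ) ≤ 2 ^ (k + 1) := by exact_mod_cast Nat.lt_two_pow_self.le
      have h3 : |y| ^ (k + 1 - 1) ≤ R ^ k := by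
        simpa using pow_le_pow_left₀ (abs_nonneg y) hy' k
      calc _ ≤ C * ((1 / 4) ^ (k + 1) / (k + 1).factorial) * (2 ^ (k + 1) * R ^ k) := by
            gcongr
            exact h _
        _ = _ := by
            rw [div_pow, div_pow, mul_pow, one_pow, pow_succ R]
            field_simp

lemma continuous_besselEntire {a : ℝ} (ha : -1 < a) : Continuous (besselEntire a) :=
  continuous_iff_continuousAt.2 fun z => (hasDerivAt_besselEntire ha z).continuousAt

lemma besselJ_eq (ν : ℝ) {r : ℝ} (hr : 0 < r) :
    besselJ ν r = (r / 2) ^ ν * besselEntire ν (r ^ 2) := by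
  rw [besselJ, besselEntire, ← tsum_mul_left]
  refine tsum_congr fun k => ?_
  have hr2 : 0 < r / 2 := by positivity
  rw [Real.rpow_add hr2, show (2 * (k : ℝ)) = ((2 * k : ℕ) : ℝ) by push_cast; ring,
    Real.rpow_natCast, besselCoeff]
  rw [show (r / 2) ^ (2 * k) = (1 / 4) ^ k * (r ^ 2) ^ k by
    rw [pow_mul, ← mul_pow]; ring_nf, show (-1 / 4 : ℝ) ^ k = (-1) ^ k * (1 / 4) ^ k by
    rw [← mul_pow]; ring_nf]
  ring

lemma mul_deriv_besselJ {a : ℝ} (ha : -1 < a) {r : ℝ} (hr : 0 < r) :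
    deriv (besselJ a) r * r =
      (r / 2) ^ a * (a * besselEntire a (r ^ 2) - r ^ 2 / 2 * besselEntire (a + 1) (r ^ 2)) := by
  have h1 : HasDerivAt (fun r : ℝ => (r / 2) ^ a * besselEntire a (r ^ 2))
      ((1 / 2 * a * (r / 2) ^ (a - 1)) * besselEntire a (r ^ 2) +
        (r / 2) ^ a * (-1 / 4 * besselEntire (a + 1) (r ^ 2) * (2 * r))) r := by
    have hA : HasDerivAt (fun r : ℝ => (r / 2) ^ a) (1 / 2 * a * (r / 2) ^ (a - 1)) r :=
      ((hasDerivAt_id r).div_const 2).rpow_const (Or.inl (by simp; positivity))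
    have hB : HasDerivAt (fun r : ℝ => r ^ 2) (2 * r) r := by simpa using hasDerivAt_pow 2 r
    exact hA.mul (HasDerivAt.comp (h₂ := besselEntire a) r (hasDerivAt_besselEntire ha (r ^ 2)) hB)
  have h2 : besselJ a =ᶠ[𝓝 r] fun r : ℝ => (r / 2) ^ a * besselEntire a (r ^ 2) := by
    filter_upwards [lt_mem_nhds hr] with y hy using besselJ_eq a hy
  rw [(h1.congr_of_eventuallyEq h2).deriv, Real.rpow_sub_one (by positivity)]
  field_simp
  ring

/-! ### The Bessel kernel as an integral -/

/-- `t ^ (a + 1) * p t` is an antiderivative of the integrand, and it vanishes at `0` because `a + 1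
> 0`. -/
lemma integral_rpow_mul_of_hasDerivAt {a : ℝ} (ha : -1 < a) {p p' g : ℝ → ℝ}
    (hp : ∀ t, HasDerivAt p (p' t) t) (hg : Continuous g)
    (h : ∀ t, (a + 1) * p t + t * p' t = g t) :
    ∫ t in (0 : ℝ)..1, t ^ a * g t = p 1 := by
  have hpc : Continuous p := continuous_iff_continuousAt.2 fun t => (hp t).continuousAt
  have key := integral_eq_sub_of_hasDerivAt_of_le (a := (0 : ℝ)) (b := 1)
    (f := fun t => t ^ (a + 1) * p t) (f' := fun t => t ^ a * g t) zero_le_one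
    ((Real.continuous_rpow_const (by linarith)).mul hpc).continuousOn ?_
    ((intervalIntegrable_rpow' ha).mul_continuousOn hg.continuousOn)
  · rw [key]
    simp [Real.zero_rpow (by linarith : a + 1 ≠ 0)]
  · intro t ht
    refine ((Real.hasDerivAt_rpow_const (Or.inl ht.1.ne')).mul (hp t)).congr_deriv ?_
    rw [← h t, add_sub_cancel_right, Real.rpow_add_one ht.1.ne']
    ring

lemma hasDerivAt_besselEntire_mul {a : ℝ} (ha : -1 < a) (x t : ℝ) :
    HasDerivAt (fun t => besselEntire a (x * t)) (-1 / 4 * besselEntire (a + 1) (x * t) * x) t := by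
  have h : HasDerivAt (fun t : ℝ => x * t) x t := by simpa using (hasDerivAt_id t).const_mul x
  exact (hasDerivAt_besselEntire ha (x * t)).comp t h

/-- Lommel's integral. The right side, with `x t` and `y t` as arguments of the Bessel series, is
the required `p`; the contiguous relation removes order `a + 2` from its derivative. -/
lemma integral_besselEntire_mul {a : ℝ} (ha : -1 < a) (x y : ℝ) :
    (x - y) * ∫ t in (0 : ℝ)..1, t ^ a * (besselEntire a (x * t) * besselEntire a (y * t)) =
      x * besselEntire (a + 1) x * besselEntire a y -
        y * besselEntire a x * besselEntire (a + 1) y := by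
  have ha1 : -1 < a + 1 := by linarith
  have hf := hasDerivAt_besselEntire_mul ha
  have hg := hasDerivAt_besselEntire_mul ha1
  have hfc := continuous_besselEntire ha
  have key := integral_rpow_mul_of_hasDerivAt ha
    (p := fun t => x * besselEntire (a + 1) (x * t) * besselEntire a (y * t) -
        y * besselEntire a (x * t) * besselEntire (a + 1) (y * t))
    (g := fun t => (x - y) * (besselEntire a (x * t) * besselEntire a (y * t)))
    (fun t => ((((hg x t).const_mul x).mul (hf y t))).sub
      (((hf x t).const_mul y).mul (hg y t))) (by fun_prop) (fun t => by
      have c1 := besselEntire_contiguous (by linarith : -2 < a) (x * t)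
      have c2 := besselEntire_contiguous (by linarith : -2 < a) (y * t)
      rw [show a + 1 + 1 = a + 2 by ring]
      linear_combination (-x * besselEntire a (y * t)) * c1 + (y * besselEntire a (x * t)) * c2)
  rw [← intervalIntegral.integral_const_mul]
  simp only [mul_one] at key
  rw [← key]
  refine intervalIntegral.integral_congr fun t _ => ?_
  ring

lemma integral_besselEntire_sq {a : ℝ} (ha : -1 < a) (x : ℝ) :
    ∫ t in (0 : ℝ)..1, t ^ a * (besselEntire a (x * t) * besselEntire a (x * t)) =
      besselEntire a x ^ 2 - a * besselEntire a x * besselEntire (a + 1) x +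
        x / 4 * besselEntire (a + 1) x ^ 2 := by
  have ha1 : -1 < a + 1 := by linarith
  have hf := hasDerivAt_besselEntire_mul ha
  have hg := hasDerivAt_besselEntire_mul ha1
  have hfc := continuous_besselEntire ha
  have hid (t : ℝ) : HasDerivAt (fun t : ℝ => x * t / 4) (x / 4) t := by
    simpa using ((hasDerivAt_id t).const_mul x).div_const 4
  have key := integral_rpow_mul_of_hasDerivAt ha
    (p := fun t => besselEntire a (x * t) ^ 2 -
      a * besselEntire a (x * t) * besselEntire (a + 1) (x * t) +
        x * t / 4 * besselEntire (a + 1) (x * t) ^ 2)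
    (g := fun t => (besselEntire a (x * t) * besselEntire a (x * t)))
    (fun t => (((hf x t).pow 2).sub (((hf x t).const_mul a).mul (hg x t))).add
      ((hid t).mul ((hg x t).pow 2))) (by fun_prop) (fun t => by
      have c1 := besselEntire_contiguous (by linarith : -2 < a) (x * t)
      rw [show a + 1 + 1 = a + 2 by ring]
      simp only [Pi.pow_apply]
      push_cast
      linear_combination (a * besselEntire a (x * t) -
        x * t / 2 * besselEntire (a + 1) (x * t)) * c1)
  simpa using key

/-- In `r J_a'(r)` the term proportional to `a J_a` drops out of the antisymmetric numerator, which
leaves exactly Lommel's expression. -/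
theorem besselKernel_eq_integral {a : ℝ} (ha : -1 < a) {x y : ℝ} (hx : 0 < x) (hy : 0 < y) :
    besselKernel a x y = (√x / 2) ^ a * (√y / 2) ^ a / 4 *
      ∫ t in (0 : ℝ)..1, t ^ a * (besselEntire a (x * t) * besselEntire a (y * t)) := by
  have hx' := Real.sqrt_pos.2 hx
  have hy' := Real.sqrt_pos.2 hy
  have hxs := Real.sq_sqrt hx.le
  have hys := Real.sq_sqrt hy.le
  unfold besselKernel
  split_ifs with h
  · subst h
    rw [integral_besselEntire_sq ha, besselJ_eq _ hx', besselJ_eq _ hx', besselJ_eq _ hx', hxs,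
      Real.rpow_add_one (by positivity), Real.rpow_sub_one (by positivity)]
    -- Order `a - 1` is expressed through orders `a` and `a + 1`.
    have c := besselEntire_contiguous (by linarith : -2 < a - 1) x
    rw [sub_add_cancel, show a - 1 + 2 = a + 1 by ring] at c
    rw [c]
    field_simp
    ring
  · have h' : x - y ≠ 0 := sub_ne_zero.2 h
    have e := integral_besselEntire_mul ha x y
    have mx := mul_deriv_besselJ ha hx'
    have my := mul_deriv_besselJ ha hy'
    rw [hxs] at mx
    rw [hys] at my
    rw [div_eq_iff (by simpa using h'), mx, besselJ_eq _ hx', besselJ_eq _ hy', hxs, hys,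
      mul_assoc, mul_comm (√y) (deriv _ _), my]
    linear_combination (-(√x / 2) ^ a * (√y / 2) ^ a / 2) * e

/-! ### Jacobi polynomials: differential equation, orthogonality, norms -/

open Polynomial in
/-- The integral of a polynomial over `[0, 1]` against the weight `u ^ a * (1 - u) ^ b`. -/
noncomputable def jacobiIntegral (a b : ℝ) (P : ℝ[X]) : ℝ :=
  ∫ u in (0 : ℝ)..1, u ^ a * (1 - u) ^ b * P.eval u

/-- The coefficients of the Jacobi polynomial, normalized to be `1` at `u = 0`. -/
noncomputable def jacobiCoeff (a b : ℝ) (n k : ℕ) : ℝ :=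
  ∏ i ∈ Finset.range k, ((i : ℝ) - n) * (n + a + b + 1 + i) / ((a + 1 + i) * (i + 1))

open Polynomial in
/-- The Jacobi polynomial in the variable `u = (1 - x) / 2`, normalized to be `1` at `u = 0`. -/
noncomputable def jacobiPoly (a b : ℝ) (n : ℕ) : ℝ[X] :=
  ∑ k ∈ Finset.range (n + 1), monomial k (jacobiCoeff a b n k)

/-- The eigenvalues of the Jacobi differential operator. -/
noncomputable def jacobiEigenvalue (a b : ℝ) (n : ℕ) : ℝ := n * (n + a + b + 1)

lemma intervalIntegrable_jacobiWeight {a b : ℝ} (ha : -1 < a) (hb : -1 < b) :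
    IntervalIntegrable (fun u : ℝ => u ^ a * (1 - u) ^ b) MeasureTheory.volume 0 1 := by
  have h := (Complex.betaIntegral_convergent (u := (a + 1 : ℝ)) (v := (b + 1 : ℝ))
    (by simp; linarith) (by simp; linarith)).norm
  refine h.congr fun u hu => ?_
  rw [uIoc_of_le zero_le_one] at hu
  have h1 : 0 ≤ 1 - u := by linarith [hu.2]
  have e1 : (u : ℂ) ^ (((a + 1 : ℝ) : ℂ) - 1) = ((u ^ a : ℝ) : ℂ) := by
    rw [Complex.ofReal_cpow hu.1.le]; congr 1; push_cast; ring
  have e2 : (1 - u : ℂ) ^ (((b + 1 : ℝ) : ℂ) - 1) = (((1 - u) ^ b : ℝ) : ℂ) := by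
    rw [Complex.ofReal_cpow h1]; push_cast; congr 1; ring
  rw [e1, e2, ← Complex.ofReal_mul, Complex.norm_real, Real.norm_of_nonneg]
  exact mul_nonneg (Real.rpow_nonneg hu.1.le _) (Real.rpow_nonneg h1 _)

lemma integral_jacobiWeight {a b : ℝ} (ha : -1 < a) (hb : -1 < b) :
    ∫ u in (0 : ℝ)..1, u ^ a * (1 - u) ^ b =
      Real.Gamma (a + 1) * Real.Gamma (b + 1) / Real.Gamma (a + b + 2) := by
  have h : ((∫ u in (0 : ℝ)..1, u ^ a * (1 - u) ^ b : ℝ) : ℂ) =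
      Complex.betaIntegral (a + 1 : ℝ) (b + 1 : ℝ) := by
    rw [Complex.betaIntegral, ← intervalIntegral.integral_ofReal]
    refine intervalIntegral.integral_congr fun u hu => ?_
    rw [uIcc_of_le zero_le_one] at hu
    have h1 : 0 ≤ 1 - u := by linarith [hu.2]
    rw [Complex.ofReal_mul, Complex.ofReal_cpow hu.1, Complex.ofReal_cpow h1]
    push_cast
    congr 2 <;> ring
  have h2 := ProbabilityTheory.beta_eq_betaIntegralReal (a + 1) (b + 1) (by linarith)
    (by linarith)
  rw [← h, Complex.ofReal_re] at h2
  rw [← h2, ProbabilityTheory.beta]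
  congr 2
  ring

section

open Polynomial

lemma intervalIntegrable_jacobiIntegrand {a b : ℝ} (ha : -1 < a) (hb : -1 < b) (P : ℝ[X]) :
    IntervalIntegrable (fun u : ℝ => u ^ a * (1 - u) ^ b * P.eval u)
      MeasureTheory.volume 0 1 :=
  (intervalIntegrable_jacobiWeight ha hb).mul_continuousOn P.continuous.continuousOn

lemma jacobiIntegral_add {a b : ℝ} (ha : -1 < a) (hb : -1 < b) (P Q : ℝ[X]) :
    jacobiIntegral a b (P + Q) = jacobiIntegral a b P + jacobiIntegral a b Q := by
  simp only [jacobiIntegral, eval_add, mul_add]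
  exact intervalIntegral.integral_add (intervalIntegrable_jacobiIntegrand ha hb P)
    (intervalIntegrable_jacobiIntegrand ha hb Q)

lemma jacobiIntegral_C_mul (a b c : ℝ) (P : ℝ[X]) :
    jacobiIntegral a b (C c * P) = c * jacobiIntegral a b P := by
  rw [jacobiIntegral, jacobiIntegral, ← intervalIntegral.integral_const_mul]
  congr 1
  ext u
  simp only [eval_mul, eval_C]
  ring

lemma jacobiIntegral_sum {a b : ℝ} (ha : -1 < a) (hb : -1 < b) {ι : Type*} (s : Finset ι)
    (P : ι → ℝ[X]) : jacobiIntegral a b (∑ i ∈ s, P i) = ∑ i ∈ s, jacobiIntegral a b (P i) := by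
  simp only [jacobiIntegral, eval_finsetSum, Finset.mul_sum]
  exact intervalIntegral.integral_finsetSum fun i _ => intervalIntegrable_jacobiIntegrand ha hb _

lemma jacobiIntegral_X_mul_one_sub_X_mul {a b : ℝ} (ha : -1 < a) (hb : -1 < b) (P : ℝ[X]) :
    jacobiIntegral a b (X * (1 - X) * P) = jacobiIntegral (a + 1) (b + 1) P := by
  refine intervalIntegral.integral_congr fun u hu => ?_
  rw [uIcc_of_le zero_le_one] at hu
  simp only [eval_mul, eval_X, eval_sub, eval_one]
  rw [Real.rpow_add_one' hu.1 (by linarith), Real.rpow_add_one' (by linarith [hu.2]) (by linarith)]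
  ring

/-- The integrand is the derivative of `u ^ (a+1) * (1-u) ^ (b+1) * P`, which vanishes at both ends.
-/
lemma jacobiIntegral_boundary {a b : ℝ} (ha : -1 < a) (hb : -1 < b) (P : ℝ[X]) :
    jacobiIntegral a b (C (a + 1) * (1 - X) * P - C (b + 1) * X * P +
      X * (1 - X) * derivative P) = 0 := by
  have key := integral_eq_sub_of_hasDerivAt_of_le (a := (0 : ℝ)) (b := 1)
    (f := fun u => u ^ (a + 1) * (1 - u) ^ (b + 1) * P.eval u)
    (f' := fun u => u ^ a * (1 - u) ^ b * (C (a + 1) * (1 - X) * P - C (b + 1) * X * P +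
      X * (1 - X) * derivative P).eval u) zero_le_one ?_ ?_
    (intervalIntegrable_jacobiIntegrand ha hb _)
  · rw [jacobiIntegral, key]
    simp [Real.zero_rpow (by linarith : a + 1 ≠ 0), Real.zero_rpow (by linarith : b + 1 ≠ 0)]
  · have h1 : Continuous fun u : ℝ => u ^ (a + 1) := Real.continuous_rpow_const (by linarith)
    have h2 : Continuous fun u : ℝ => (1 - u) ^ (b + 1) :=
      (Real.continuous_rpow_const (by linarith)).comp (by fun_prop : Continuous fun u : ℝ => 1 - u)
    exact ((h1.mul h2).mul P.continuous).continuousOn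
  · intro u hu
    have h1 : 0 < 1 - u := by linarith [hu.2]
    have d1 := Real.hasDerivAt_rpow_const (x := u) (p := a + 1) (Or.inl hu.1.ne')
    have d2 : HasDerivAt (fun u : ℝ => (1 - u) ^ (b + 1)) (-1 * (b + 1) * (1 - u) ^ (b + 1 - 1)) u :=
      ((hasDerivAt_id u).const_sub 1).rpow_const (Or.inl h1.ne')
    refine ((d1.mul d2).mul (P.hasDerivAt u)).congr_deriv ?_
    simp only [eval_mul, eval_X, eval_sub, eval_one, eval_add, eval_C, add_sub_cancel_right]
    simp only [Pi.mul_apply]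
    rw [Real.rpow_add_one hu.1.ne', Real.rpow_add_one h1.ne']
    ring

lemma jacobiCoeff_succ (a b : ℝ) (n k : ℕ) :
    jacobiCoeff a b n (k + 1) = jacobiCoeff a b n k *
      (((k : ℝ) - n) * (n + a + b + 1 + k) / ((a + 1 + k) * (k + 1))) :=
  Finset.prod_range_succ _ _

lemma jacobiCoeff_eq_zero (a b : ℝ) {n k : ℕ} (h : n < k) : jacobiCoeff a b n k = 0 :=
  Finset.prod_eq_zero (Finset.mem_range.2 h) (by simp)

lemma coeff_jacobiPoly (a b : ℝ) (n k : ℕ) :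
    (jacobiPoly a b n).coeff k = jacobiCoeff a b n k := by
  rw [jacobiPoly, finsetSum_coeff]
  simp only [coeff_monomial]
  rw [Finset.sum_ite_eq']
  split_ifs with h
  · rfl
  · rw [jacobiCoeff_eq_zero]
    simpa using h

/-- `(k - n) (n + a + b + 1 + k)` is the eigenvalue difference `λ_k - λ_n`. Both the differential
equation and the Bessel limit rest on this form. -/
lemma jacobiCoeff_succ_mul {a : ℝ} (ha : -1 < a) (b : ℝ) (n k : ℕ) :
    (k + 1) * (k + a + 1) * jacobiCoeff a b n (k + 1) =
      (k * (k + a + b + 1) - jacobiEigenvalue a b n) * jacobiCoeff a b n k := by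
  have h1 : (a + 1 + k) ≠ 0 := by have : (0 : ℝ) ≤ k := k.cast_nonneg; linarith
  have h2 : (k + 1 : ℝ) ≠ 0 := by positivity
  rw [jacobiCoeff_succ, jacobiEigenvalue]
  field_simp
  ring

lemma jacobiPoly_ode {a : ℝ} (ha : -1 < a) (b : ℝ) (n : ℕ) :
    X * (1 - X) * derivative (derivative (jacobiPoly a b n)) +
      (C (a + 1) - C (a + b + 2) * X) * derivative (jacobiPoly a b n) +
      C (jacobiEigenvalue a b n) * jacobiPoly a b n = 0 := by
  have e : ∀ Q : ℝ[X], X * (1 - X) * derivative (derivative Q) +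
      (C (a + 1) - C (a + b + 2) * X) * derivative Q + C (jacobiEigenvalue a b n) * Q =
      X * derivative (derivative Q) - X * (X * derivative (derivative Q)) +
      C (a + 1) * derivative Q - C (a + b + 2) * (X * derivative Q) +
        C (jacobiEigenvalue a b n) * Q := fun Q => by ring
  rw [e]
  ext k
  have r := jacobiCoeff_succ_mul ha b n k
  rcases k with _ | _ | k
  · simp [coeff_derivative, coeff_jacobiPoly, -map_add] at r ⊢
    linear_combination r
  · simp [coeff_derivative, coeff_jacobiPoly, mul_assoc, -map_add] at r ⊢
    linear_combination r
  · simp [coeff_derivative, coeff_jacobiPoly, mul_assoc, -map_add] at r ⊢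
    linear_combination r

/-- Integration by parts, with the second derivative eliminated by the differential equation.
Exchanging the roles of two Jacobi polynomials gives orthogonality; taking `P` equal to the
polynomial gives the norm recurrence. -/
lemma jacobiIntegral_derivative_mul_derivative {a b : ℝ} (ha : -1 < a) (hb : -1 < b) (n : ℕ)
    (P : ℝ[X]) :
    jacobiIntegral (a + 1) (b + 1) (derivative (jacobiPoly a b n) * derivative P) =
      jacobiEigenvalue a b n * jacobiIntegral a b (jacobiPoly a b n * P) := by
  have h := jacobiIntegral_boundary ha hb (derivative (jacobiPoly a b n) * P)
  have ode := jacobiPoly_ode ha b n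
  set Q := jacobiPoly a b n
  have e : C (a + 1) * (1 - X) * (derivative Q * P) - C (b + 1) * X * (derivative Q * P) +
      X * (1 - X) * derivative (derivative Q * P) =
      C (-jacobiEigenvalue a b n) * (Q * P) + X * (1 - X) * (derivative Q * derivative P) := by
    rw [show a + b + 2 = (a + 1) + (b + 1) by ring, C_add (a := a + 1)] at ode
    rw [derivative_mul, C_neg]
    linear_combination P * ode
  rw [e, jacobiIntegral_add ha hb, jacobiIntegral_C_mul,
    jacobiIntegral_X_mul_one_sub_X_mul ha hb] at h
  linarith

lemma jacobiEigenvalue_lt {a b : ℝ} (ha : -1 < a) (hb : -1 < b) {m n : ℕ} (h : m < n) :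
    jacobiEigenvalue a b m < jacobiEigenvalue a b n := by
  have h1 : (m + 1 : ℝ) ≤ n := by exact_mod_cast h
  have h2 : (0 : ℝ) ≤ m := m.cast_nonneg
  unfold jacobiEigenvalue
  nlinarith

lemma jacobiEigenvalue_nonneg {a b : ℝ} (ha : -1 < a) (hb : -1 < b) (n : ℕ) :
    0 ≤ jacobiEigenvalue a b n := by
  rcases n.eq_zero_or_pos with rfl | h
  · simp [jacobiEigenvalue]
  · simpa [jacobiEigenvalue] using (jacobiEigenvalue_lt ha hb h).le

lemma jacobiIntegral_mul_eq_zero {a b : ℝ} (ha : -1 < a) (hb : -1 < b) {m n : ℕ} (h : m ≠ n) :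
    jacobiIntegral a b (jacobiPoly a b m * jacobiPoly a b n) = 0 := by
  have h1 := jacobiIntegral_derivative_mul_derivative ha hb m (jacobiPoly a b n)
  have h2 := jacobiIntegral_derivative_mul_derivative ha hb n (jacobiPoly a b m)
  rw [mul_comm (derivative (jacobiPoly a b n)), mul_comm (jacobiPoly a b n), h1] at h2
  have h3 : jacobiEigenvalue a b m ≠ jacobiEigenvalue a b n := by
    rcases lt_or_gt_of_ne h with h | h
    · exact (jacobiEigenvalue_lt ha hb h).ne
    · exact (jacobiEigenvalue_lt ha hb h).ne'
  exact (mul_eq_mul_right_iff.1 h2).resolve_left h3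

lemma jacobiCoeff_succ_succ {a : ℝ} (ha : -1 < a) (b : ℝ) (n k : ℕ) :
    jacobiCoeff a b (n + 1) (k + 1) * (k + 1) =
      -jacobiEigenvalue a b (n + 1) / (a + 1) * jacobiCoeff (a + 1) (b + 1) n k := by
  induction k with
  | zero =>
    have h : a + 1 ≠ 0 := by linarith
    simp [jacobiCoeff, jacobiEigenvalue]
    ring
  | succ k ih =>
    have h1 : (a + 1 + 1 + k) ≠ 0 := by have : (0 : ℝ) ≤ k := k.cast_nonneg; linarith
    have h1' : (a + 1 + (k + 1)) ≠ 0 := by have : (0 : ℝ) ≤ k := k.cast_nonneg; linarith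
    have h2 : (k + 1 : ℝ) ≠ 0 := by positivity
    have h3 : (k + 1 + 1 : ℝ) ≠ 0 := by positivity
    rw [jacobiCoeff_succ, jacobiCoeff_succ (a + 1), ← mul_assoc, ← ih]
    push_cast
    rw [show a + 1 + 1 + (k : ℝ) = a + 1 + (k + 1) by ring]
    field_simp
    ring

lemma derivative_jacobiPoly {a : ℝ} (ha : -1 < a) (b : ℝ) (n : ℕ) :
    derivative (jacobiPoly a b (n + 1)) =
      C (-jacobiEigenvalue a b (n + 1) / (a + 1)) * jacobiPoly (a + 1) (b + 1) n := by
  ext k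
  rw [coeff_derivative, coeff_C_mul, coeff_jacobiPoly, coeff_jacobiPoly,
    jacobiCoeff_succ_succ ha]

lemma jacobiPoly_zero (a b : ℝ) : jacobiPoly a b 0 = 1 := by
  simp [jacobiPoly, jacobiCoeff]

lemma jacobiIntegral_sq_zero {a b : ℝ} (ha : -1 < a) (hb : -1 < b) :
    jacobiIntegral a b (jacobiPoly a b 0 * jacobiPoly a b 0) =
      Real.Gamma (a + 1) * Real.Gamma (b + 1) / Real.Gamma (a + b + 2) := by
  rw [← integral_jacobiWeight ha hb, jacobiIntegral]
  simp [jacobiPoly_zero]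

lemma jacobiIntegral_sq_recurrence {a b : ℝ} (ha : -1 < a) (hb : -1 < b) (n : ℕ) :
    jacobiIntegral a b (jacobiPoly a b (n + 1) * jacobiPoly a b (n + 1)) =
      jacobiEigenvalue a b (n + 1) / (a + 1) ^ 2 * jacobiIntegral (a + 1) (b + 1)
        (jacobiPoly (a + 1) (b + 1) n * jacobiPoly (a + 1) (b + 1) n) := by
  have hpos : 0 < jacobiEigenvalue a b (n + 1) := by
    simpa [jacobiEigenvalue] using jacobiEigenvalue_lt ha hb n.succ_pos
  have h := jacobiIntegral_derivative_mul_derivative ha hb (n + 1) (jacobiPoly a b (n + 1))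
  rw [derivative_jacobiPoly ha, mul_mul_mul_comm, ← C_mul, jacobiIntegral_C_mul] at h
  have := hpos.ne'
  have h1 : a + 1 ≠ 0 := by linarith
  field_simp at h ⊢
  linear_combination -h

/-- The recurrence lowers the degree and raises both parameters, so the induction runs over all `a`,
`b`. Degree `0` is excluded because the formula would there contain `(a + b + 1) Γ(a + b + 1)`,
degenerate at `a + b = -1`. -/
lemma jacobiIntegral_sq_succ {a b : ℝ} (ha : -1 < a) (hb : -1 < b) (n : ℕ) :
    jacobiIntegral a b (jacobiPoly a b (n + 1) * jacobiPoly a b (n + 1)) =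
      (n + 1).factorial * Real.Gamma (a + 1) ^ 2 * Real.Gamma (b + n + 2) /
        (Real.Gamma (a + n + 2) * Real.Gamma (a + b + n + 2) * (a + b + 2 * n + 3)) := by
  induction n generalizing a b with
  | zero =>
    rw [jacobiIntegral_sq_recurrence ha hb, jacobiIntegral_sq_zero (by linarith) (by linarith)]
    have hGa : Real.Gamma (a + 1 + 1) = (a + 1) * Real.Gamma (a + 1) :=
      Real.Gamma_add_one (by linarith)
    have h1 : a + 1 ≠ 0 := by linarith
    have hG1 : Real.Gamma (a + 1) ≠ 0 := (Real.Gamma_pos_of_pos (by linarith)).ne'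
    have h3 : a + b + 3 ≠ 0 := by linarith
    have h2 : a + b + 2 ≠ 0 := by linarith
    have hG2 : Real.Gamma (a + b + 2) ≠ 0 := (Real.Gamma_pos_of_pos (by linarith)).ne'
    have e : Real.Gamma (a + 1 + (b + 1) + 2) =
        (a + b + 3) * ((a + b + 2) * Real.Gamma (a + b + 2)) := by
      rw [← Real.Gamma_add_one h2, show a + b + 2 + 1 = a + b + 3 by ring, ← Real.Gamma_add_one h3]
      congr 1; ring
    have e2 : a + ((0 : ℕ) : ℝ) + 2 = a + 1 + 1 := by push_cast; ring
    have e3 : b + 1 + 1 = b + ((0 : ℕ) : ℝ) + 2 := by push_cast; ring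
    rw [e, e2, hGa, e3, jacobiEigenvalue]
    simp
    field_simp
    ring
  | succ n ih =>
    have hn : (0 : ℝ) ≤ n := n.cast_nonneg
    have h1 : a + 1 ≠ 0 := by linarith
    have h2 : a + b + n + 3 ≠ 0 := by linarith
    have h3 : a + b + 2 * n + 5 ≠ 0 := by linarith
    have hG1 : Real.Gamma (a + n + 3) ≠ 0 := (Real.Gamma_pos_of_pos (by linarith)).ne'
    have hG2 : Real.Gamma (a + b + n + 3) ≠ 0 := (Real.Gamma_pos_of_pos (by linarith)).ne'
    rw [jacobiIntegral_sq_recurrence ha hb, ih (by linarith) (by linarith), Real.Gamma_add_one h1]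
    have e1 : a + 1 + (n : ℝ) + 2 = a + n + 3 := by ring
    have e2 : a + ((n + 1 : ℕ) : ℝ) + 2 = a + n + 3 := by push_cast; ring
    have e3 : b + 1 + (n : ℝ) + 2 = b + ((n + 1 : ℕ) : ℝ) + 2 := by push_cast; ring
    have e4 : a + 1 + (b + 1) + (n : ℝ) + 2 = a + b + n + 3 + 1 := by ring
    have e5 : a + b + ((n + 1 : ℕ) : ℝ) + 2 = a + b + n + 3 := by push_cast; ring
    have e6 : a + 1 + (b + 1) + 2 * (n : ℝ) + 3 = a + b + 2 * n + 5 := by ring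
    have e7 : a + b + 2 * ((n + 1 : ℕ) : ℝ) + 3 = a + b + 2 * n + 5 := by push_cast; ring
    rw [e1, e2, e3, e4, e5, e6, e7, Real.Gamma_add_one h2, Nat.factorial_succ (n + 1),
      jacobiEigenvalue]
    push_cast
    rw [show (n : ℝ) + 1 + 1 + a + b + 1 = a + b + n + 3 by ring]
    field_simp

lemma jacobiIntegral_sq_pos {a b : ℝ} (ha : -1 < a) (hb : -1 < b) (n : ℕ) :
    0 < jacobiIntegral a b (jacobiPoly a b n * jacobiPoly a b n) := by
  have hG : ∀ {x : ℝ}, 0 < x → 0 < Real.Gamma x := Real.Gamma_pos_of_pos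
  rcases n with _ | n
  · rw [jacobiIntegral_sq_zero ha hb]
    exact div_pos (mul_pos (hG (by linarith)) (hG (by linarith))) (hG (by linarith))
  · have hn : (0 : ℝ) ≤ n := n.cast_nonneg
    rw [jacobiIntegral_sq_succ ha hb]
    have h1 := hG (by linarith : 0 < a + 1)
    have h2 := hG (by linarith : 0 < b + n + 2)
    have h3 := hG (by linarith : 0 < a + n + 2)
    have h4 := hG (by linarith : 0 < a + b + n + 2)
    have h5 : 0 < a + b + 2 * n + 3 := by linarith
    positivity

/-- The Christoffel sum `∑ j < n, Q_j(0) ^ 2 / ‖Q_j‖ ^ 2` of the Jacobi polynomials. -/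
noncomputable def christoffelSum (a b : ℝ) (n : ℕ) : ℝ :=
  ∑ j ∈ Finset.range n, (jacobiIntegral a b (jacobiPoly a b j * jacobiPoly a b j))⁻¹

/-- As `Q_j(0) = 1`, this is the Christoffel–Darboux kernel at the endpoint, where it has a closed
form. -/
lemma christoffelSum_succ_eq {a b : ℝ} (ha : -1 < a) (hb : -1 < b) (n : ℕ) :
    christoffelSum a b (n + 1) = Real.Gamma (a + b + n + 2) * Real.Gamma (a + n + 2) /
      (Real.Gamma (a + 1) * Real.Gamma (a + 2) * n.factorial * Real.Gamma (b + n + 1)) := by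
  have hG : ∀ {x : ℝ}, 0 < x → Real.Gamma x ≠ 0 := fun h => (Real.Gamma_pos_of_pos h).ne'
  induction n with
  | zero =>
    rw [christoffelSum, Finset.sum_range_one, jacobiIntegral_sq_zero ha hb]
    have := hG (by linarith : 0 < a + 1)
    have := hG (by linarith : 0 < a + 2)
    have := hG (by linarith : 0 < b + 1)
    have := hG (by linarith : 0 < a + b + 2)
    simp
    field_simp
  | succ n ih =>
    have hn : (0 : ℝ) ≤ n := n.cast_nonneg
    rw [christoffelSum, Finset.sum_range_succ, ← christoffelSum, ih, jacobiIntegral_sq_succ ha hb]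
    have e1 : a + b + ((n + 1 : ℕ) : ℝ) + 2 = a + b + n + 2 + 1 := by push_cast; ring
    have e2 : a + ((n + 1 : ℕ) : ℝ) + 2 = a + n + 2 + 1 := by push_cast; ring
    have e3 : b + ((n + 1 : ℕ) : ℝ) + 1 = b + n + 1 + 1 := by push_cast; ring
    have e4 : b + (n : ℝ) + 2 = b + n + 1 + 1 := by ring
    have e5 : a + 2 = a + 1 + 1 := by ring
    have h1 : a + 1 ≠ 0 := by linarith
    have h2 : b + n + 1 ≠ 0 := by linarith
    have h3 : a + b + n + 2 ≠ 0 := by linarith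
    have h4 : a + n + 2 ≠ 0 := by linarith
    have h5 : a + b + 2 * n + 3 ≠ 0 := by linarith
    rw [e1, e2, e3, e4, e5, Real.Gamma_add_one h1, Real.Gamma_add_one h2, Real.Gamma_add_one h3,
      Real.Gamma_add_one h4, Nat.factorial_succ]
    have := hG (by linarith : 0 < a + 1)
    have := hG (by linarith : 0 < b + n + 1)
    have := hG (by linarith : 0 < a + b + n + 2)
    have := hG (by linarith : 0 < a + n + 2)
    push_cast
    field_simp
    ring

end

/-! ### Gram–Schmidt and the kernel in terms of Jacobi polynomials -/

section

open Polynomial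

lemma jacobiCoeff_self_ne_zero {a b : ℝ} (ha : -1 < a) (hb : -1 < b) (n : ℕ) :
    jacobiCoeff a b n n ≠ 0 := by
  refine Finset.prod_ne_zero_iff.2 fun i hi => ?_
  have h1 : (i + 1 : ℝ) ≤ n := by exact_mod_cast Finset.mem_range.1 hi
  have h2 : (0 : ℝ) ≤ i := i.cast_nonneg
  have h3 : (i : ℝ) - n ≠ 0 := by linarith
  have h4 : (n : ℝ) + a + b + 1 + i ≠ 0 := by linarith
  have h5 : a + 1 + i ≠ 0 := by linarith
  have h6 : (i : ℝ) + 1 ≠ 0 := by linarith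
  exact div_ne_zero (mul_ne_zero h3 h4) (mul_ne_zero h5 h6)

lemma exists_eq_sum_jacobiPoly {a b : ℝ} (ha : -1 < a) (hb : -1 < b) (n : ℕ) (P : ℝ[X])
    (hP : ∀ m, n ≤ m → P.coeff m = 0) :
    ∃ d : ℕ → ℝ, P = ∑ k ∈ Finset.range n, C (d k) * jacobiPoly a b k := by
  induction n generalizing P with
  | zero =>
    refine ⟨0, ?_⟩
    ext m
    simp [hP m m.zero_le]
  | succ n ih =>
    have hl := jacobiCoeff_self_ne_zero ha hb n
    set c := P.coeff n / jacobiCoeff a b n n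
    obtain ⟨d, hd⟩ := ih (P - C c * jacobiPoly a b n) fun m hm => by
      rw [coeff_sub, coeff_C_mul, coeff_jacobiPoly]
      rcases hm.eq_or_lt with rfl | h
      · rw [div_mul_cancel₀ _ hl, sub_self]
      · rw [hP m h, jacobiCoeff_eq_zero _ _ h, mul_zero, sub_zero]
    refine ⟨Function.update d n c, ?_⟩
    rw [Finset.sum_range_succ, Function.update_self, ← sub_eq_iff_eq_add, hd]
    refine Finset.sum_congr rfl fun k hk => ?_
    rw [Function.update_of_ne (Finset.mem_range.1 hk).ne]

lemma eq_sum_jacobiPoly {a b : ℝ} (ha : -1 < a) (hb : -1 < b) (n : ℕ) (P : ℝ[X])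
    (hP : ∀ m, n ≤ m → P.coeff m = 0) :
    P = ∑ k ∈ Finset.range n, C (jacobiIntegral a b (jacobiPoly a b k * P) /
      jacobiIntegral a b (jacobiPoly a b k * jacobiPoly a b k)) * jacobiPoly a b k := by
  obtain ⟨d, hd⟩ := exists_eq_sum_jacobiPoly ha hb n P hP
  nth_rw 1 [hd]
  refine Finset.sum_congr rfl fun k hk => ?_
  congr 2
  rw [eq_div_iff (jacobiIntegral_sq_pos ha hb k).ne', hd, Finset.mul_sum,
    jacobiIntegral_sum ha hb, Finset.sum_eq_single k]
  · rw [mul_left_comm, jacobiIntegral_C_mul]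
  · intro j _ hj
    rw [mul_left_comm, jacobiIntegral_C_mul, jacobiIntegral_mul_eq_zero ha hb hj.symm, mul_zero]
  · exact fun h => absurd hk h

/-- The function `x ↦ (1 - x) ^ (a / 2) * (1 + x) ^ (b / 2) * P ((1 - x) / 2)`. -/
noncomputable def weightedPoly (a b : ℝ) (P : ℝ[X]) (x : ℝ) : ℝ :=
  (1 - x) ^ (a / 2) * (1 + x) ^ (b / 2) * P.eval ((1 - x) / 2)

lemma weightedMonomial_eq (a b : ℝ) (n : ℕ) :
    weightedMonomial a b n = weightedPoly a b ((C (-2) * X + C 1) ^ n) := by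
  ext x
  have e : -2 * ((1 - x) / 2) + 1 = x := by ring
  simp only [weightedMonomial, weightedPoly, eval_pow, eval_add, eval_mul, eval_C, eval_X, e]
  ring

lemma innerProd_weightedPoly (a b : ℝ) (P R : ℝ[X]) :
    innerProd (weightedPoly a b P) (weightedPoly a b R) =
      2 ^ (a + b + 1) * jacobiIntegral a b (P * R) := by
  have h := intervalIntegral.integral_comp_sub_mul (a := (0 : ℝ)) (b := 1)
    (fun x => weightedPoly a b P x * weightedPoly a b R x) (two_ne_zero (α := ℝ)) 1
  norm_num at h
  rw [innerProd, show (∫ x in (-1 : ℝ)..1, weightedPoly a b P x * weightedPoly a b R x) =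
    2 * ∫ u in (0 : ℝ)..1, weightedPoly a b P (1 - 2 * u) * weightedPoly a b R (1 - 2 * u) by
      rw [h]; ring, Real.rpow_add_one two_ne_zero, Real.rpow_add two_pos, jacobiIntegral,
      ← intervalIntegral.integral_const_mul, ← intervalIntegral.integral_const_mul]
  refine intervalIntegral.integral_congr fun u hu => ?_
  rw [uIcc_of_le zero_le_one] at hu
  have h1 : 0 ≤ 1 - u := by linarith [hu.2]
  have e1 : (1 - (1 - 2 * u)) = 2 * u := by ring
  have e2 : (1 + (1 - 2 * u)) = 2 * (1 - u) := by ring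
  have e3 : (2 * u / 2) = u := by ring
  have sq : ∀ {z c : ℝ}, 0 ≤ z → (z ^ (c / 2)) ^ 2 = z ^ c := fun hz => by
    rw [← Real.rpow_mul_natCast hz]; congr 1; push_cast; ring
  simp only [weightedPoly, e1, e2, e3, eval_mul]
  have s1 := sq (c := a) (mul_nonneg zero_le_two hu.1)
  have s2 := sq (c := b) (mul_nonneg zero_le_two h1)
  rw [Real.mul_rpow (z := a) zero_le_two hu.1] at s1
  rw [Real.mul_rpow (z := b) zero_le_two h1] at s2
  calc _ = 2 * (((2 * u) ^ (a / 2)) ^ 2 * ((2 * (1 - u)) ^ (b / 2)) ^ 2 *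
        (eval u P * eval u R)) := by ring
    _ = _ := by rw [s1, s2]; ring

/-- Choose `α` to match the leading coefficient of `M = (1 - 2u) ^ n`. Then `M - α Q_n` has degree
below `n`, and by orthogonality its Jacobi coefficients are those of `M`, so it is the projection
that Gram–Schmidt subtracts. The scalars from earlier steps cancel in each projection. -/
lemma exists_orthogonalFun_eq {a b : ℝ} (ha : -1 < a) (hb : -1 < b) (n : ℕ) :
    ∃ α : ℝ, α ≠ 0 ∧ orthogonalFun a b n = weightedPoly a b (C α * jacobiPoly a b n) := by
  induction n using Nat.strong_induction_on with
  | _ n ih =>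
    have hl := jacobiCoeff_self_ne_zero ha hb n
    set M : ℝ[X] := (C (-2) * X + C 1) ^ n with hM
    have hdeg : M.natDegree = n := by
      rw [hM, natDegree_pow, natDegree_linear (by norm_num), mul_one]
    have hlead : M.coeff n = (-2) ^ n := by
      have : M.leadingCoeff = (-2) ^ n := by
        rw [hM, leadingCoeff_pow, leadingCoeff_linear (by norm_num)]
      rw [← this, leadingCoeff, hdeg]
    have hlead0 : M.coeff n ≠ 0 := by rw [hlead]; exact pow_ne_zero _ (by norm_num)
    set α := M.coeff n / jacobiCoeff a b n n
    refine ⟨α, div_ne_zero hlead0 hl, ?_⟩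
    have hR := eq_sum_jacobiPoly ha hb n (M - C α * jacobiPoly a b n) fun m hm => by
      rw [coeff_sub, coeff_C_mul, coeff_jacobiPoly]
      rcases hm.eq_or_lt with rfl | h
      · rw [div_mul_cancel₀ _ hl, sub_self]
      · rw [coeff_eq_zero_of_natDegree_lt (hdeg.trans_lt h), jacobiCoeff_eq_zero _ _ h,
          mul_zero, sub_zero]
    have hproj : ∀ k ∈ Finset.range n,
        jacobiIntegral a b (jacobiPoly a b k * (M - C α * jacobiPoly a b n)) =
          jacobiIntegral a b (jacobiPoly a b k * M) := fun k hk => by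
      have e : jacobiPoly a b k * (M - C α * jacobiPoly a b n) =
        jacobiPoly a b k * M + C (-α) * (jacobiPoly a b k * jacobiPoly a b n) := by
        rw [C_neg]; ring
      rw [e, jacobiIntegral_add ha hb, jacobiIntegral_C_mul,
        jacobiIntegral_mul_eq_zero ha hb (Finset.mem_range.1 hk).ne, mul_zero, add_zero]
    have hE : C α * jacobiPoly a b n = M - ∑ k ∈ Finset.range n,
        C (jacobiIntegral a b (jacobiPoly a b k * M) /
          jacobiIntegral a b (jacobiPoly a b k * jacobiPoly a b k)) * jacobiPoly a b k := by
      rw [← Finset.sum_congr rfl fun k hk => by rw [← hproj k hk], ← hR]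
      ring
    have hterm : ∀ x, ∀ k : Fin n,
        innerProd (orthogonalFun a b k) (weightedMonomial a b n) /
          innerProd (orthogonalFun a b k) (orthogonalFun a b k) * orthogonalFun a b k x =
        (1 - x) ^ (a / 2) * (1 + x) ^ (b / 2) *
          (jacobiIntegral a b (jacobiPoly a b k * M) /
            jacobiIntegral a b (jacobiPoly a b k * jacobiPoly a b k) *
              (jacobiPoly a b k).eval ((1 - x) / 2)) := fun x k => by
      obtain ⟨β, hβ, h⟩ := ih k k.2
      have hk := (jacobiIntegral_sq_pos ha hb k).ne'
      have h2 : (2 : ℝ) ^ (a + b + 1) ≠ 0 := (Real.rpow_pos_of_pos two_pos _).ne'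
      rw [weightedMonomial_eq, ← hM, h, innerProd_weightedPoly, innerProd_weightedPoly, mul_assoc,
        jacobiIntegral_C_mul, mul_mul_mul_comm, ← C_mul, jacobiIntegral_C_mul, weightedPoly,
        eval_mul, eval_C]
      field_simp
    ext x
    rw [orthogonalFun, hE, Finset.sum_congr rfl fun k _ => hterm x k, weightedMonomial_eq, ← hM,
      Fin.sum_univ_eq_sum_range (fun k => (1 - x) ^ (a / 2) * (1 + x) ^ (b / 2) *
          (jacobiIntegral a b (jacobiPoly a b k * M) /
            jacobiIntegral a b (jacobiPoly a b k * jacobiPoly a b k) *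
              (jacobiPoly a b k).eval ((1 - x) / 2)))]
    simp only [weightedPoly, eval_sub, eval_finsetSum, eval_mul, eval_C, mul_sub, Finset.mul_sum]

theorem kernel_eq_sum_jacobiPoly {a b : ℝ} (ha : -1 < a) (hb : -1 < b) (N : ℕ) (x y : ℝ) :
    kernel a b N x y = (1 - x) ^ (a / 2) * (1 + x) ^ (b / 2) *
      ((1 - y) ^ (a / 2) * (1 + y) ^ (b / 2)) / 2 ^ (a + b + 1) *
      ∑ j ∈ Finset.range N, (jacobiIntegral a b (jacobiPoly a b j * jacobiPoly a b j))⁻¹ *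
        ((jacobiPoly a b j).eval ((1 - x) / 2) * (jacobiPoly a b j).eval ((1 - y) / 2)) := by
  rw [kernel, Finset.mul_sum]
  refine Finset.sum_congr rfl fun j _ => ?_
  obtain ⟨β, hβ, h⟩ := exists_orthogonalFun_eq ha hb j
  have hj := jacobiIntegral_sq_pos ha hb j
  have h2 : (0 : ℝ) < 2 ^ (a + b + 1) := Real.rpow_pos_of_pos two_pos _
  have hn : innerProd (orthogonalFun a b j) (orthogonalFun a b j) =
      2 ^ (a + b + 1) * (β ^ 2 * jacobiIntegral a b (jacobiPoly a b j * jacobiPoly a b j)) := by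
    rw [h, innerProd_weightedPoly, mul_mul_mul_comm, ← C_mul, jacobiIntegral_C_mul, sq]
  have hs := Real.mul_self_sqrt (mul_nonneg h2.le (mul_nonneg (sq_nonneg β) hj.le))
  rw [phi, phi, hn, div_mul_div_comm, hs, h, weightedPoly, weightedPoly, eval_mul, eval_mul, eval_C,
    eval_C]
  field_simp

end

/-! ### Gamma quotients up to a relative error `O(1/n)` -/

/-- The sequence `r n` is `1 + O(1 / n)`. -/
def IsOneAddBigO (r : ℕ → ℝ) : Prop :=
  (fun n => r n - 1) =O[atTop] fun n : ℕ => (n : ℝ)⁻¹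

lemma IsOneAddBigO.tendsto {r : ℕ → ℝ} (h : IsOneAddBigO r) : Tendsto r atTop (𝓝 1) := by
  have h1 := IsBigO.trans_tendsto h tendsto_inv_atTop_nhds_zero_nat
  simpa using h1.add_const 1

lemma IsOneAddBigO.mul {r q : ℕ → ℝ} (hr : IsOneAddBigO r) (hq : IsOneAddBigO q) :
    IsOneAddBigO fun n => r n * q n := by
  have h1 : (fun n => (r n - 1) * q n) =O[atTop] fun n : ℕ => (n : ℝ)⁻¹ := by
    simpa using IsBigO.mul hr (hq.tendsto.isBigO_one ℝ)
  refine (h1.add hq).congr_left fun n => ?_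
  ring

lemma IsOneAddBigO.comp {r : ℕ → ℝ} (hr : IsOneAddBigO r) {g : ℝ → ℝ} (hg1 : g 1 = 1)
    (hg : DifferentiableAt ℝ g 1) : IsOneAddBigO fun n => g (r n) := by
  have h := (hg.isBigO_sub.comp_tendsto hr.tendsto).trans hr
  rwa [hg1] at h

lemma IsOneAddBigO.rpow {r : ℕ → ℝ} (hr : IsOneAddBigO r) (p : ℝ) :
    IsOneAddBigO fun n => r n ^ p :=
  hr.comp (g := fun z => z ^ p) (Real.one_rpow p)
    (Real.differentiableAt_rpow_const_of_ne p one_ne_zero)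

lemma IsOneAddBigO.inv {r : ℕ → ℝ} (hr : IsOneAddBigO r) : IsOneAddBigO fun n => (r n)⁻¹ :=
  hr.comp (g := fun z => z⁻¹) inv_one (differentiableAt_inv one_ne_zero)

lemma IsOneAddBigO.congr {r q : ℕ → ℝ} (hr : IsOneAddBigO r) (h : r =ᶠ[atTop] q) :
    IsOneAddBigO q :=
  IsBigO.congr' hr (h.mono fun n hn => by simp only [hn]) EventuallyEq.rfl

lemma isOneAddBigO_one_add_div (α : ℝ) : IsOneAddBigO fun n => 1 + α / n := by
  refine ((isBigO_refl (fun n : ℕ => (n : ℝ)⁻¹) atTop).const_mul_left α).congr_left fun n => ?_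
  rw [add_sub_cancel_left, div_eq_mul_inv]

/-- Log-convexity of Gamma between `x` and `x + 1`. -/
lemma Gamma_add_le_rpow_mul_Gamma {x θ : ℝ} (hx : 0 < x) (h0 : 0 < θ) (h1 : θ < 1) :
    Real.Gamma (x + θ) ≤ x ^ θ * Real.Gamma x := by
  have hG := Real.Gamma_pos_of_pos hx
  have h := Real.Gamma_mul_add_mul_le_rpow_Gamma_mul_rpow_Gamma hx (by linarith : 0 < x + 1)
    (sub_pos.2 h1) h0 (by ring)
  rw [Real.Gamma_add_one hx.ne', Real.mul_rpow hx.le hG.le, mul_left_comm, ← Real.rpow_add hG,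
    sub_add_cancel, Real.rpow_one] at h
  convert h using 2
  ring

/-- Log-convexity bounds the quotient `r` above by `1`. Applied from `n + α` up to `n + 1`, it also
gives `n ≤ (n + α) r`, hence `1 - r ≤ α / n`. -/
lemma isOneAddBigO_Gamma_of_lt_one {α : ℝ} (h0 : 0 ≤ α) (h1 : α < 1) :
    IsOneAddBigO fun n => Real.Gamma (n + α) / (Real.Gamma n * (n : ℝ) ^ α) := by
  refine IsBigO.of_bound α ?_
  filter_upwards [eventually_ge_atTop 1] with n hn
  have hn0 : (0 : ℝ) < n := by exact_mod_cast hn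
  have hG := Real.Gamma_pos_of_pos hn0
  have hp : 0 < (n : ℝ) ^ α := Real.rpow_pos_of_pos hn0 _
  rcases h0.eq_or_lt with rfl | h0
  · simp [hG.ne']
  have u := Gamma_add_le_rpow_mul_Gamma hn0 h0 h1
  have l := Gamma_add_le_rpow_mul_Gamma (by linarith : 0 < (n : ℝ) + α) (sub_pos.2 h1)
    (sub_lt_self 1 h0)
  rw [add_add_sub_cancel, Real.Gamma_add_one hn0.ne', Real.rpow_sub (by linarith),
    Real.rpow_one] at l
  have hG2 := Real.Gamma_pos_of_pos (by linarith : 0 < (n : ℝ) + α)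
  have hp2 : (n : ℝ) ^ α ≤ (n + α) ^ α := Real.rpow_le_rpow hn0.le (by linarith) h0.le
  have hl : n * Real.Gamma n * (n : ℝ) ^ α ≤ (n + α) * Real.Gamma (n + α) := by
    calc _ ≤ (n + α) / (n + α) ^ α * Real.Gamma (n + α) * (n : ℝ) ^ α := by gcongr
      _ ≤ (n + α) / (n + α) ^ α * Real.Gamma (n + α) * (n + α) ^ α := by gcongr
      _ = _ := by
        have : ((n : ℝ) + α) ^ α ≠ 0 := (hp.trans_le hp2).ne'
        field_simp
  set r := Real.Gamma (n + α) / (Real.Gamma n * (n : ℝ) ^ α) with hr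
  have r1 : r ≤ 1 := (div_le_one (mul_pos hG hp)).2 (by linarith)
  have r2 : (n : ℝ) ≤ (n + α) * r := by
    rw [hr, ← mul_div_assoc, le_div_iff₀ (mul_pos hG hp)]
    linarith
  rw [norm_inv, Real.norm_natCast, Real.norm_eq_abs, abs_le, ← div_eq_mul_inv, neg_le,
    le_div_iff₀ hn0]
  constructor
  · nlinarith
  · exact (sub_nonpos.2 r1).trans (by positivity)

/-- The functional equation moves the fractional part of `α` by integer steps in both directions. -/
lemma isOneAddBigO_Gamma (α : ℝ) :
    IsOneAddBigO fun n => Real.Gamma (n + α) / (Real.Gamma n * (n : ℝ) ^ α) := by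
  have hstep : ∀ β : ℝ, ∀ᶠ n : ℕ in atTop,
      Real.Gamma (n + (β + 1)) / (Real.Gamma n * (n : ℝ) ^ (β + 1)) =
        Real.Gamma (n + β) / (Real.Gamma n * (n : ℝ) ^ β) * (1 + β / n) := fun β => by
    filter_upwards [eventually_ge_atTop 1,
      tendsto_natCast_atTop_atTop.eventually_gt_atTop (-β)] with n hn hβ
    have hn0 : (0 : ℝ) < n := by exact_mod_cast hn
    have hG := (Real.Gamma_pos_of_pos hn0).ne'
    have hp := (Real.rpow_pos_of_pos hn0 β).ne'
    rw [← add_assoc, Real.Gamma_add_one (by linarith : 0 < (n : ℝ) + β).ne',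
      Real.rpow_add_one hn0.ne']
    field_simp
  have key : ∀ k : ℤ, IsOneAddBigO fun n =>
      Real.Gamma (n + (Int.fract α + k)) / (Real.Gamma n * (n : ℝ) ^ (Int.fract α + k)) := by
    intro k
    induction k using Int.induction_on with
    | zero =>
      simpa using isOneAddBigO_Gamma_of_lt_one (Int.fract_nonneg α) (Int.fract_lt_one α)
    | succ k ih =>
      refine (ih.mul (isOneAddBigO_one_add_div (Int.fract α + (k : ℤ)))).congr ?_
      filter_upwards [hstep (Int.fract α + (k : ℤ))] with n hn
      rw [← hn]
      push_cast
      rw [add_assoc (Int.fract α)]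
    | pred k ih =>
      have h2 := isOneAddBigO_one_add_div (Int.fract α + ((-k - 1 : ℤ) : ℝ))
      refine (ih.mul h2.inv).congr ?_
      filter_upwards [hstep (Int.fract α + ((-k - 1 : ℤ) : ℝ)),
        h2.tendsto.eventually_ne one_ne_zero] with n hn hne
      have e : Int.fract α + ((-k - 1 : ℤ) : ℝ) + 1 = Int.fract α + ((-k : ℤ) : ℝ) := by
        push_cast; ring
      rw [e] at hn
      rw [hn, mul_assoc, mul_inv_cancel₀ hne, mul_one]
  simpa using key ⌊α⌋

/-- The Gamma exponents add up to `(a + b + 1) + (a + 1) - b = 2a + 2`; the dependence on `b`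
cancels. -/
lemma isOneAddBigO_christoffelSum {a b : ℝ} (ha : -1 < a) (hb : -1 < b) :
    IsOneAddBigO fun n => Real.Gamma (a + 1) * Real.Gamma (a + 2) * christoffelSum a b n /
      (n : ℝ) ^ (2 * a + 2) := by
  refine (((isOneAddBigO_Gamma (a + b + 1)).mul (isOneAddBigO_Gamma (a + 1))).mul
    (isOneAddBigO_Gamma b).inv).congr ?_
  filter_upwards [eventually_ge_atTop 1] with n hn
  obtain ⟨m, rfl⟩ := Nat.exists_eq_add_of_le' hn
  have hm : (0 : ℝ) ≤ m := m.cast_nonneg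
  have hn0 : (0 : ℝ) < (m + 1 : ℕ) := by positivity
  have hG1 := (Real.Gamma_pos_of_pos (by linarith : 0 < a + 1)).ne'
  have hG2 := (Real.Gamma_pos_of_pos (by linarith : 0 < a + 2)).ne'
  have hG4 := (Real.Gamma_pos_of_pos (by linarith : 0 < b + m + 1)).ne'
  rw [christoffelSum_succ_eq ha hb, show 2 * a + 2 = (a + b + 1) + (a + 1) - b by ring,
    Real.rpow_sub hn0, Real.rpow_add hn0 (a + b + 1) (a + 1)]
  have e1 : ((m + 1 : ℕ) : ℝ) + (a + b + 1) = a + b + m + 2 := by push_cast; ring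
  have e2 : ((m + 1 : ℕ) : ℝ) + (a + 1) = a + m + 2 := by push_cast; ring
  have e3 : ((m + 1 : ℕ) : ℝ) + b = b + m + 1 := by push_cast; ring
  have e4 : Real.Gamma ((m + 1 : ℕ) : ℝ) = m.factorial := by
    push_cast; exact Real.Gamma_nat_eq_factorial m
  have hf : (m.factorial : ℝ) ≠ 0 := by exact_mod_cast m.factorial_ne_zero
  have p1 := (Real.rpow_pos_of_pos hn0 (a + b + 1)).ne'
  have p2 := (Real.rpow_pos_of_pos hn0 (a + 1)).ne'
  have p3 := (Real.rpow_pos_of_pos hn0 b).ne'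
  rw [e1, e2, e3, e4]
  generalize ((m + 1 : ℕ) : ℝ) ^ (a + b + 1) = q1 at *
  generalize ((m + 1 : ℕ) : ℝ) ^ (a + 1) = q2 at *
  generalize ((m + 1 : ℕ) : ℝ) ^ b = q3 at *
  field_simp

lemma isOneAddBigO_jacobiEigenvalue_rpow (a b p : ℝ) :
    IsOneAddBigO fun n => (jacobiEigenvalue a b n / (n : ℝ) ^ 2) ^ p := by
  refine ((isOneAddBigO_one_add_div (a + b + 1)).rpow p).congr ?_
  filter_upwards [eventually_ge_atTop 1] with n hn
  have hn0 : (n : ℝ) ≠ 0 := by exact_mod_cast (by omega : n ≠ 0)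
  congr 1
  rw [jacobiEigenvalue]
  field_simp
  ring

/-- The bound must hold from `n = 1` on, since the summation by parts meets every index up to `N`.
-/
lemma IsOneAddBigO.exists_abs_sub_le {r q : ℕ → ℝ} (hr : IsOneAddBigO r) (hq : IsOneAddBigO q) :
    ∃ C : ℝ, 0 < C ∧ ∀ n : ℕ, 1 ≤ n → |r n - q n| ≤ C / n := by
  have h : (fun n => r n - q n) =O[atTop] fun n : ℕ => (n : ℝ)⁻¹ :=
    (IsBigO.sub hr hq).congr_left fun n => by ring
  obtain ⟨C, hC, h⟩ := bound_of_isBigO_nat_atTop h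
  refine ⟨C, hC, fun n hn => ?_⟩
  have hn0 : (0 : ℝ) < n := by exact_mod_cast hn
  have := h (inv_pos.2 hn0).ne'
  rwa [norm_inv, Real.norm_natCast, Real.norm_eq_abs, ← div_eq_mul_inv] at this

lemma isOneAddBigO_one : IsOneAddBigO fun _ => 1 := by
  simpa using isOneAddBigO_one_add_div 0

/-! ### From weighted sums to integrals -/

lemma abs_integral_rpow_mul_le {a : ℝ} (ha : -1 < a) {x y B : ℝ} (hx : 0 ≤ x) (hy : 0 ≤ y)
    {h : ℝ → ℝ} (hB : ∀ t ∈ uIcc x y, |h t| ≤ B) :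
    |(a + 1) * ∫ t in x..y, t ^ a * h t| ≤ B * |y ^ (a + 1) - x ^ (a + 1)| := by
  have ha1 : 0 < a + 1 := by linarith
  wlog hxy : x ≤ y generalizing x y
  · rw [intervalIntegral.integral_symm, mul_neg, abs_neg, abs_sub_comm]
    exact this hy hx (by rwa [uIcc_comm]) (le_of_not_ge hxy)
  have h1 : ‖∫ t in x..y, t ^ a * h t‖ ≤ ∫ t in x..y, t ^ a * B := by
    refine intervalIntegral.norm_integral_le_of_norm_le hxy ?_
      ((intervalIntegrable_rpow' ha).mul_const B)
    refine MeasureTheory.ae_of_all _ fun t ht => ?_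
    have ht0 : 0 ≤ t := hx.trans ht.1.le
    rw [Real.norm_eq_abs, abs_mul, abs_of_nonneg (Real.rpow_nonneg ht0 a)]
    exact mul_le_mul_of_nonneg_left (hB t (by rw [uIcc_of_le hxy]; exact ⟨ht.1.le, ht.2⟩))
      (Real.rpow_nonneg ht0 a)
  rw [intervalIntegral.integral_mul_const, integral_rpow (Or.inl ha), Real.norm_eq_abs] at h1
  rw [abs_mul, abs_of_pos ha1,
    abs_of_nonneg (sub_nonneg.2 (Real.rpow_le_rpow hx hxy ha1.le))]
  calc _ ≤ (a + 1) * ((y ^ (a + 1) - x ^ (a + 1)) / (a + 1) * B) := by gcongr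
    _ = _ := by field_simp

/-- Each cell has mass `t (j+1) ^ (a+1) - t j ^ (a+1)` for the measure `(a+1) u ^ a du`, and `g`
varies there by at most `L * δ`; the masses telescope. -/
lemma abs_riemann_sum_sub_integral_le {a : ℝ} (ha : -1 < a) {t : ℕ → ℝ} (ht : Monotone t)
    (ht0 : t 0 = 0) {N : ℕ} {δ L : ℝ} (hL : 0 ≤ L) (hδ : ∀ j < N, t (j + 1) - t j ≤ δ)
    {g : ℝ → ℝ} (hg : Continuous g)
    (hgL : ∀ u ∈ Icc 0 (t N), ∀ v ∈ Icc 0 (t N), |g u - g v| ≤ L * |u - v|) :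
    |∑ j ∈ Finset.range N, (t (j + 1) ^ (a + 1) - t j ^ (a + 1)) * g (t j) -
      (a + 1) * ∫ u in (0 : ℝ)..t N, u ^ a * g u| ≤ L * δ * t N ^ (a + 1) := by
  have ha1 : 0 < a + 1 := by linarith
  have htn : ∀ j, 0 ≤ t j := fun j => ht0.symm.le.trans (ht j.zero_le)
  have hint : ∀ x y : ℝ, IntervalIntegrable (fun u => u ^ a * g u) MeasureTheory.volume x y :=
    fun x y => (intervalIntegrable_rpow' ha).mul_continuousOn hg.continuousOn
  have hsplit := intervalIntegral.sum_integral_adjacent_intervals (a := t) (n := N)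
    (f := fun u => u ^ a * g u) (μ := MeasureTheory.volume) fun k _ => hint _ _
  rw [ht0] at hsplit
  have htel := Finset.sum_range_sub (fun j => t j ^ (a + 1)) N
  rw [ht0, Real.zero_rpow ha1.ne', sub_zero] at htel
  rw [← hsplit, Finset.mul_sum, ← Finset.sum_sub_distrib, ← htel, Finset.mul_sum]
  refine (Finset.abs_sum_le_sum_abs _ _).trans (Finset.sum_le_sum fun j hj => ?_)
  have hjN := Finset.mem_range.1 hj
  have hle : t j ≤ t (j + 1) := ht j.le_succ
  have hN1 : t (j + 1) ≤ t N := ht hjN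
  have hd := hδ j hjN
  have e : (t (j + 1) ^ (a + 1) - t j ^ (a + 1)) * g (t j) -
      (a + 1) * ∫ u in t j..t (j + 1), u ^ a * g u =
      (a + 1) * ∫ u in t j..t (j + 1), u ^ a * (g (t j) - g u) := by
    simp only [mul_sub]
    rw [intervalIntegral.integral_sub ((intervalIntegrable_rpow' ha).mul_const _) (hint _ _),
      intervalIntegral.integral_mul_const, integral_rpow (Or.inl ha), mul_sub]
    field_simp
  rw [e]
  refine (abs_integral_rpow_mul_le ha (htn j) (htn _) (B := L * δ) fun u hu => ?_).trans_eq ?_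
  · rw [uIcc_of_le hle] at hu
    refine (hgL _ ⟨htn j, hle.trans hN1⟩ u ⟨(htn j).trans hu.1, hu.2.trans hN1⟩).trans ?_
    refine mul_le_mul_of_nonneg_left ?_ hL
    rw [abs_le]
    constructor <;> linarith [hu.1, hu.2]
  · rw [abs_of_nonneg (sub_nonneg.2 (Real.rpow_le_rpow (htn j) hle ha1.le))]

lemma sum_range_sub_mul (E g : ℕ → ℝ) (N : ℕ) :
    ∑ j ∈ Finset.range N, (E (j + 1) - E j) * g j =
      E N * g N - E 0 * g 0 - ∑ j ∈ Finset.range N, E (j + 1) * (g (j + 1) - g j) := by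
  induction N with
  | zero => simp
  | succ N ih => rw [Finset.sum_range_succ, Finset.sum_range_succ, ih]; ring

/-- The bound for all the ratios `λ_j / N ^ 2`, `j ≤ N`. -/
noncomputable def jacobiBound (a b : ℝ) : ℝ := 1 + |a + b + 1|

lemma jacobiEigenvalue_succ_sub_le (a b : ℝ) (j : ℕ) :
    jacobiEigenvalue a b (j + 1) - jacobiEigenvalue a b j ≤ 2 * jacobiBound a b * (j + 1) := by
  have h1 := le_abs_self (a + b + 1)
  have h2 := abs_nonneg (a + b + 1)
  have h3 : (0 : ℝ) ≤ j := j.cast_nonneg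
  unfold jacobiEigenvalue jacobiBound
  push_cast
  nlinarith

lemma jacobiEigenvalue_le (a b : ℝ) {j N : ℕ} (hj : j ≤ N) :
    jacobiEigenvalue a b j ≤ jacobiBound a b * N ^ 2 := by
  have h1 := le_abs_self (a + b + 1)
  have h2 := abs_nonneg (a + b + 1)
  have h3 : (0 : ℝ) ≤ j := j.cast_nonneg
  have h4 : (j : ℝ) ≤ N := by exact_mod_cast hj
  have h5 : (j : ℝ) ≤ (j : ℝ) ^ 2 := by exact_mod_cast Nat.le_self_pow two_ne_zero j
  have h6 : (j : ℝ) ^ 2 ≤ (N : ℝ) ^ 2 := pow_le_pow_left₀ h3 h4 2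
  have h7 : (j : ℝ) * (a + b + 1) ≤ j ^ 2 * |a + b + 1| :=
    (mul_le_mul_of_nonneg_left h1 h3).trans (mul_le_mul_of_nonneg_right h5 h2)
  unfold jacobiEigenvalue jacobiBound
  nlinarith

theorem exists_abs_sum_sub_integral_le {a b : ℝ} (ha : -1 < a) (hb : -1 < b) :
    ∃ C : ℝ, 0 < C ∧ ∀ N : ℕ, 1 ≤ N → ∀ (g : ℝ → ℝ) (G L : ℝ), Continuous g → 0 ≤ L →
      (∀ u ∈ Icc 0 (jacobiBound a b), |g u| ≤ G) →
      (∀ u ∈ Icc 0 (jacobiBound a b), ∀ v ∈ Icc 0 (jacobiBound a b),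
        |g u - g v| ≤ L * |u - v|) →
      |Real.Gamma (a + 1) * Real.Gamma (a + 2) / (N : ℝ) ^ (2 * a + 2) *
          ∑ j ∈ Finset.range N, (jacobiIntegral a b (jacobiPoly a b j * jacobiPoly a b j))⁻¹ *
            g (jacobiEigenvalue a b j / (N : ℝ) ^ 2) -
        (a + 1) * ∫ u in (0 : ℝ)..1, u ^ a * g u| ≤ C * (G + L) / N := by
  have ha1 : 0 < a + 1 := by linarith
  obtain ⟨C₁, hC₁, h₁⟩ := (isOneAddBigO_christoffelSum ha hb).exists_abs_sub_le
    (isOneAddBigO_jacobiEigenvalue_rpow a b (a + 1))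
  obtain ⟨C₂, hC₂, h₂⟩ := (isOneAddBigO_jacobiEigenvalue_rpow a b (a + 1)).exists_abs_sub_le
    isOneAddBigO_one
  set T := jacobiBound a b with hT
  have hT1 : 1 ≤ T := le_add_of_nonneg_right (abs_nonneg _)
  have hT0 : 0 < T := one_pos.trans_le hT1
  have hTp : 0 < T ^ (a + 1) := Real.rpow_pos_of_pos hT0 _
  refine ⟨C₁ + C₂ + C₁ * (2 * T) + 2 * T * T ^ (a + 1), by positivity,
    fun N hN g G L hg hL hgG hgL => ?_⟩
  have hN0 : (0 : ℝ) < N := by exact_mod_cast hN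
  have hG : 0 ≤ G := (abs_nonneg _).trans (hgG 0 ⟨le_rfl, hT0.le⟩)
  set κ := Real.Gamma (a + 1) * Real.Gamma (a + 2) with hκ
  set t : ℕ → ℝ := fun j => jacobiEigenvalue a b j / (N : ℝ) ^ 2 with ht
  have ht0 : t 0 = 0 := by simp [ht, jacobiEigenvalue]
  have htm : Monotone t := monotone_nat_of_le_succ fun j =>
    div_le_div_of_nonneg_right (jacobiEigenvalue_lt ha hb j.lt_succ_self).le (by positivity)
  have htn : ∀ j, 0 ≤ t j := fun j => ht0.symm.le.trans (htm j.zero_le)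
  have htT : ∀ j ≤ N, t j ≤ T := fun j hj => by
    rw [ht]
    exact (div_le_iff₀ (by positivity)).2 (jacobiEigenvalue_le a b hj)
  have hstep : ∀ j : ℕ, t (j + 1) - t j ≤ 2 * T * (j + 1) / (N : ℝ) ^ 2 := fun j => by
    simp only [ht]
    rw [← sub_div]
    exact div_le_div_of_nonneg_right (jacobiEigenvalue_succ_sub_le a b j) (by positivity)
  -- `E` is the gap between the rescaled partial sums of `1 / h_j` and the distribution function `t
  -- ^ (a+1)` at the nodes.
  set E : ℕ → ℝ := fun j => κ / (N : ℝ) ^ (2 * a + 2) * christoffelSum a b j - t j ^ (a + 1)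
    with hE
  have hE0 : E 0 = 0 := by
    simp [hE, christoffelSum, ht0, Real.zero_rpow ha1.ne']
  have hEj : ∀ j : ℕ, 1 ≤ j → j ≤ N → |E j| ≤ C₁ / j := fun j hj hjN => by
    have hj0 : (0 : ℝ) < j := by exact_mod_cast hj
    have hjN' : (j : ℝ) ≤ N := by exact_mod_cast hjN
    have p1 := Real.rpow_pos_of_pos hj0 (2 * a + 2)
    have p2 := Real.rpow_pos_of_pos hN0 (2 * a + 2)
    have sq : ∀ {z : ℝ}, 0 < z → z ^ (2 * a + 2) = (z ^ 2) ^ (a + 1) := fun hz => by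
      rw [← Real.rpow_natCast_mul hz.le]; congr 1; push_cast; ring
    have e : E j = (j : ℝ) ^ (2 * a + 2) / (N : ℝ) ^ (2 * a + 2) *
        (κ * christoffelSum a b j / (j : ℝ) ^ (2 * a + 2) -
          (jacobiEigenvalue a b j / (j : ℝ) ^ 2) ^ (a + 1)) := by
      have hl := jacobiEigenvalue_nonneg ha hb j
      simp only [hE, ht]
      rw [Real.div_rpow hl (by positivity), Real.div_rpow hl (by positivity), ← sq hj0, ← sq hN0]
      field_simp
    rw [e, abs_mul, abs_of_pos (div_pos p1 p2)]
    refine (mul_le_of_le_one_left (abs_nonneg _) ?_).trans (h₁ j hj)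
    exact (div_le_one p2).2 (Real.rpow_le_rpow hj0.le hjN' (by linarith))
  have hsum : κ / (N : ℝ) ^ (2 * a + 2) *
      ∑ j ∈ Finset.range N, (jacobiIntegral a b (jacobiPoly a b j * jacobiPoly a b j))⁻¹ * g (t j) =
      ∑ j ∈ Finset.range N, (E (j + 1) - E j) * g (t j) +
        ∑ j ∈ Finset.range N, (t (j + 1) ^ (a + 1) - t j ^ (a + 1)) * g (t j) := by
    rw [← Finset.sum_add_distrib, Finset.mul_sum]
    refine Finset.sum_congr rfl fun j _ => ?_
    simp only [hE, christoffelSum, Finset.sum_range_succ]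
    ring
  have hA : |∑ j ∈ Finset.range N, (E (j + 1) - E j) * g (t j)| ≤
      C₁ / N * G + C₁ * (2 * T) * L / N := by
    rw [sum_range_sub_mul E (fun j => g (t j)), hE0, zero_mul, sub_zero]
    refine (abs_sub _ _).trans (add_le_add ?_ ?_)
    · rw [abs_mul]
      exact mul_le_mul (hEj N hN le_rfl) (hgG _ ⟨htn N, htT N le_rfl⟩) (abs_nonneg _)
        (by positivity)
    · have : ∀ j ∈ Finset.range N, |E (j + 1) * (g (t (j + 1)) - g (t j))| ≤
          C₁ * (2 * T) * L / (N : ℝ) ^ 2 := fun j hj => by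
        have hjN : j + 1 ≤ N := Finset.mem_range.1 hj
        have d := hgL (t (j + 1)) ⟨htn _, htT _ hjN⟩ (t j) ⟨htn _, htT _ (by omega)⟩
        rw [abs_of_nonneg (sub_nonneg.2 (htm j.le_succ))] at d
        have e1 := hEj (j + 1) (by omega) hjN
        rw [abs_mul]
        -- The decay `1 / (j+1)` of `E` cancels the growth `j + 1` of the node spacing, so each of
        -- the `N` terms is `O(N⁻²)`.
        calc _ ≤ C₁ / (j + 1 : ℕ) * (L * (2 * T * (j + 1) / (N : ℝ) ^ 2)) :=
              mul_le_mul e1 (d.trans (mul_le_mul_of_nonneg_left (hstep j) hL)) (abs_nonneg _)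
                (by positivity)
          _ = _ := by
              push_cast
              have : (j + 1 : ℝ) ≠ 0 := by positivity
              field_simp
      refine (Finset.abs_sum_le_sum_abs _ _).trans ((Finset.sum_le_sum this).trans_eq ?_)
      rw [Finset.sum_const, Finset.card_range, nsmul_eq_mul]
      field_simp
  have hB := abs_riemann_sum_sub_integral_le ha htm ht0 (N := N) (δ := 2 * T / N) hL
    (fun j hj => (hstep j).trans (by
      have : (j + 1 : ℝ) ≤ N := by exact_mod_cast hj
      calc _ ≤ 2 * T * N / (N : ℝ) ^ 2 := by gcongr
        _ = _ := by field_simp)) hg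
    fun u hu v hv => hgL u ⟨hu.1, hu.2.trans (htT N le_rfl)⟩ v ⟨hv.1, hv.2.trans (htT N le_rfl)⟩
  have hB' : L * (2 * T / N) * t N ^ (a + 1) ≤ L * (2 * T / N) * T ^ (a + 1) := by
    gcongr
    · exact htn N
    · exact htT N le_rfl
  -- The last node `t N` is only `1 + O(1/N)`; this accounts for the integral between `1` and `t N`.
  have hD := abs_integral_rpow_mul_le ha zero_le_one (htn N) (B := G) (h := g) fun u hu =>
    hgG u ⟨(le_min zero_le_one (htn N)).trans hu.1, hu.2.trans (max_le hT1 (htT N le_rfl))⟩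
  rw [Real.one_rpow] at hD
  have hD' := hD.trans (mul_le_mul_of_nonneg_left (h₂ N hN) hG)
  have hint : ∀ x y : ℝ, IntervalIntegrable (fun u => u ^ a * g u) MeasureTheory.volume x y :=
    fun x y => (intervalIntegrable_rpow' ha).mul_continuousOn hg.continuousOn
  have hadd := intervalIntegral.integral_add_adjacent_intervals (hint 0 1) (hint 1 (t N))
  rw [hsum]
  rw [← hadd, mul_add] at hB
  set A := ∑ j ∈ Finset.range N, (E (j + 1) - E j) * g (t j)
  set B := ∑ j ∈ Finset.range N, (t (j + 1) ^ (a + 1) - t j ^ (a + 1)) * g (t j)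
  set I := (a + 1) * ∫ u in (0 : ℝ)..1, u ^ a * g u
  set J := (a + 1) * ∫ u in (1 : ℝ)..t N, u ^ a * g u
  calc |A + B - I| = |A + (B - (I + J)) + J| := by congr 1; ring
    _ ≤ |A| + |B - (I + J)| + |J| := abs_add_three _ _ _
    _ ≤ (C₁ / N * G + C₁ * (2 * T) * L / N) + L * (2 * T / N) * T ^ (a + 1) + G * (C₂ / N) :=
        add_le_add (add_le_add hA (hB.trans hB')) hD'
    -- Nonnegative terms are added to bring the bound to the form `C * (G + L) / N`.
    _ ≤ ((C₁ / N * G + C₁ * (2 * T) * L / N) + L * (2 * T / N) * T ^ (a + 1) + G * (C₂ / N)) +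
        ((C₁ + C₂) * L + (C₁ * (2 * T) + 2 * T * T ^ (a + 1)) * G) / N :=
        le_add_of_nonneg_right (by positivity)
    _ = _ := by ring

/-! ### Jacobi polynomials near the endpoint: the Bessel limit -/

/-- The product that replaces the power `(λ_j / N ^ 2) ^ k` in the coefficients of the rescaled
Jacobi polynomial. -/
noncomputable def eigenvalueProd (a b : ℝ) (N j k : ℕ) : ℝ :=
  ∏ i ∈ Finset.range k,
    (jacobiEigenvalue a b j / (N : ℝ) ^ 2 - jacobiEigenvalue a b i / (N : ℝ) ^ 2)

lemma eigenvalueProd_succ (a b : ℝ) (N j k : ℕ) :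
    eigenvalueProd a b N j (k + 1) = eigenvalueProd a b N j k *
      (jacobiEigenvalue a b j / (N : ℝ) ^ 2 - jacobiEigenvalue a b k / (N : ℝ) ^ 2) :=
  Finset.prod_range_succ _ _

lemma jacobiEigenvalue_div_mem {a b : ℝ} (ha : -1 < a) (hb : -1 < b) {j N : ℕ} (hN : 1 ≤ N)
    (hj : j ≤ N) : jacobiEigenvalue a b j / (N : ℝ) ^ 2 ∈ Icc 0 (jacobiBound a b) := by
  have hN0 : (0 : ℝ) < N := by exact_mod_cast hN
  exact ⟨div_nonneg (jacobiEigenvalue_nonneg ha hb j) (by positivity),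
    (div_le_iff₀ (by positivity)).2 (jacobiEigenvalue_le a b hj)⟩

lemma one_le_jacobiBound (a b : ℝ) : 1 ≤ jacobiBound a b :=
  le_add_of_nonneg_right (abs_nonneg _)

/-- For `k ≤ j` all eigenvalues involved are in range; for `k > j` the factor with `i = j` vanishes.
Hence no upper limit on `k` is needed. -/
lemma abs_eigenvalueProd_le {a b : ℝ} (ha : -1 < a) (hb : -1 < b) {j N : ℕ} (hN : 1 ≤ N)
    (hj : j ≤ N) (k : ℕ) : |eigenvalueProd a b N j k| ≤ jacobiBound a b ^ k := by
  have hT := one_le_jacobiBound a b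
  by_cases hk : k ≤ j
  · rw [eigenvalueProd, Finset.abs_prod, ← Finset.card_range k, ← Finset.prod_const,
      Finset.card_range]
    refine Finset.prod_le_prod (fun _ _ => abs_nonneg _) fun i hi => ?_
    have h1 := jacobiEigenvalue_div_mem ha hb hN hj
    have h2 := jacobiEigenvalue_div_mem ha hb hN
      ((Finset.mem_range.1 hi).le.trans (hk.trans hj))
    rw [abs_le]
    constructor <;> linarith [h1.1, h1.2, h2.1, h2.2]
  · rw [eigenvalueProd, Finset.prod_eq_zero (Finset.mem_range.2 (not_le.1 hk)) (sub_self _),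
      abs_zero]
    positivity

/-- Each new factor differs from `λ_j / N²` by `O(k² / N²)`; the cube of `k` bounds the accumulated
squares. -/
lemma abs_eigenvalueProd_sub_pow_le {a b : ℝ} (ha : -1 < a) (hb : -1 < b) {j N : ℕ}
    (hN : 1 ≤ N) (hj : j ≤ N) (k : ℕ) :
    |eigenvalueProd a b N j k - (jacobiEigenvalue a b j / (N : ℝ) ^ 2) ^ k| ≤
      jacobiBound a b ^ (k + 1) * k ^ 3 / (N : ℝ) ^ 2 := by
  have hN0 : (0 : ℝ) < N := by exact_mod_cast hN
  have hT := one_le_jacobiBound a b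
  have hT0 : 0 < jacobiBound a b := by linarith
  induction k with
  | zero => simp [eigenvalueProd]
  | succ k ih =>
    have h1 := jacobiEigenvalue_div_mem ha hb hN hj
    have h2 := abs_eigenvalueProd_le ha hb hN hj k
    have h3 : jacobiEigenvalue a b k / (N : ℝ) ^ 2 ≤ jacobiBound a b * k ^ 2 / (N : ℝ) ^ 2 :=
      div_le_div_of_nonneg_right (jacobiEigenvalue_le a b le_rfl) (by positivity)
    have h4 : 0 ≤ jacobiEigenvalue a b k / (N : ℝ) ^ 2 :=
      div_nonneg (jacobiEigenvalue_nonneg ha hb k) (by positivity)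
    rw [eigenvalueProd_succ]
    set D := eigenvalueProd a b N j k
    set t := jacobiEigenvalue a b j / (N : ℝ) ^ 2
    set e := jacobiEigenvalue a b k / (N : ℝ) ^ 2
    set T := jacobiBound a b
    calc |D * (t - e) - t ^ (k + 1)| = |(D - t ^ k) * t - D * e| := by congr 1; ring
      _ ≤ |D - t ^ k| * t + |D| * e := by
        refine (abs_sub _ _).trans_eq ?_
        rw [abs_mul, abs_mul, abs_of_nonneg h1.1, abs_of_nonneg h4]
      _ ≤ (T ^ (k + 1) * k ^ 3 / (N : ℝ) ^ 2) * T + T ^ k * (T * k ^ 2 / (N : ℝ) ^ 2) := by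
        gcongr
        · exact h1.1
        · exact h1.2
      _ = (T ^ (k + 1) * k ^ 3 * T + T ^ (k + 1) * k ^ 2 * 1) / (N : ℝ) ^ 2 := by ring
      _ ≤ (T ^ (k + 1) * k ^ 3 * T + T ^ (k + 1) * k ^ 2 * T) / (N : ℝ) ^ 2 := by gcongr
      _ = T ^ (k + 2) * (k ^ 3 + k ^ 2) / (N : ℝ) ^ 2 := by ring
      _ ≤ T ^ (k + 1 + 1) * (k + 1 : ℕ) ^ 3 / (N : ℝ) ^ 2 := by
        gcongr
        push_cast
        have : (0 : ℝ) ≤ k := k.cast_nonneg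
        nlinarith

/-- An exact identity: after rescaling, the Jacobi and Bessel series differ only by `eigenvalueProd`
standing in place of `(λ_j / N²) ^ k`. -/
lemma jacobiCoeff_mul_pow {a : ℝ} (ha : -1 < a) (b : ℝ) (N j k : ℕ) (x : ℝ) :
    jacobiCoeff a b j k * (x / (4 * (N : ℝ) ^ 2)) ^ k =
      Real.Gamma (a + 1) * (besselCoeff a k * x ^ k * eigenvalueProd a b N j k) := by
  induction k with
  | zero =>
    have hG := (Real.Gamma_pos_of_pos (by linarith : 0 < a + 1)).ne'
    simp [jacobiCoeff, besselCoeff, eigenvalueProd]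
    field_simp
  | succ k ih =>
    have h1 := jacobiCoeff_succ_mul ha b j k
    have h2 := succ_mul_besselCoeff_succ a k
    have h3 := besselCoeff_eq_mul a k
    have h4 : (k : ℝ) + a + 1 ≠ 0 := by have : (0 : ℝ) ≤ k := k.cast_nonneg; linarith
    have h5 : (k : ℝ) + 1 ≠ 0 := by positivity
    have e : (k + 1) * (k + a + 1) * besselCoeff a (k + 1) = -1 / 4 * besselCoeff a k := by
      rw [h3]; linear_combination (k + a + 1) * h2
    have hk : jacobiEigenvalue a b k = k * (k + a + b + 1) := rfl
    refine mul_left_cancel₀ (mul_ne_zero h5 h4) ?_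
    rw [eigenvalueProd_succ, ← sub_div]
    calc _ = (k + 1) * (k + a + 1) * jacobiCoeff a b j (k + 1) *
          (x / (4 * (N : ℝ) ^ 2)) ^ (k + 1) := by ring
      _ = (jacobiEigenvalue a b k - jacobiEigenvalue a b j) * (x / (4 * (N : ℝ) ^ 2)) *
          (jacobiCoeff a b j k * (x / (4 * (N : ℝ) ^ 2)) ^ k) := by rw [h1, hk]; ring
      _ = Real.Gamma (a + 1) * (-1 / 4 * besselCoeff a k) * x ^ (k + 1) *
          eigenvalueProd a b N j k *
            ((jacobiEigenvalue a b j - jacobiEigenvalue a b k) / (N : ℝ) ^ 2) := by rw [ih]; ring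
      _ = _ := by rw [← e]; ring

lemma hasSum_jacobiPoly_eval (a b : ℝ) (j : ℕ) (u : ℝ) :
    HasSum (fun k => jacobiCoeff a b j k * u ^ k) ((jacobiPoly a b j).eval u) := by
  have e : (jacobiPoly a b j).eval u =
      ∑ k ∈ Finset.range (j + 1), jacobiCoeff a b j k * u ^ k := by
    simp [jacobiPoly, Polynomial.eval_finsetSum]
  rw [e]
  refine hasSum_sum_of_ne_finset_zero fun k hk => ?_
  rw [jacobiCoeff_eq_zero, zero_mul]
  simpa using hk

theorem exists_abs_jacobiPoly_sub_besselEntire_le {a b : ℝ} (ha : -1 < a) (hb : -1 < b)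
    {M : ℝ} (hM : 0 ≤ M) :
    ∃ C : ℝ, 0 ≤ C ∧ ∀ N : ℕ, 1 ≤ N → ∀ j ≤ N, ∀ x ∈ Icc 0 M,
      |(jacobiPoly a b j).eval (x / (4 * (N : ℝ) ^ 2)) -
        Real.Gamma (a + 1) * besselEntire a (x * (jacobiEigenvalue a b j / (N : ℝ) ^ 2))| ≤
        C / (N : ℝ) ^ 2 := by
  obtain ⟨c, hc, h⟩ := exists_abs_besselCoeff_le ha
  have hG := Real.Gamma_pos_of_pos (by linarith : 0 < a + 1)
  have hT := one_le_jacobiBound a b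
  set T := jacobiBound a b
  have hT0 : 0 < T := by linarith
  -- The base `2 * M * T` is `M * T` times the `1/4` of the Bessel coefficients times the `8` from
  -- `k ^ 3 ≤ 8 ^ k`.
  have hs : HasSum (fun k : ℕ => Real.Gamma (a + 1) * c * T * ((2 * M * T) ^ k / k.factorial)) _ :=
    ((Real.summable_pow_div_factorial (2 * M * T)).mul_left _).hasSum
  refine ⟨∑' k : ℕ, Real.Gamma (a + 1) * c * T * ((2 * M * T) ^ k / k.factorial),
    tsum_nonneg fun k => by positivity, fun N hN j hj x hx => ?_⟩
  have hN0 : (0 : ℝ) < N := by exact_mod_cast hN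
  set t := jacobiEigenvalue a b j / (N : ℝ) ^ 2 with ht
  have h1 := hasSum_jacobiPoly_eval a b j (x / (4 * (N : ℝ) ^ 2))
  have h2 := (hasSum_besselEntire ha (x * t)).mul_left (Real.Gamma (a + 1))
  rw [← (h1.sub h2).tsum_eq, ← Real.norm_eq_abs]
  refine tsum_of_norm_bounded (hs.div_const _) fun k => ?_
  have e : jacobiCoeff a b j k * (x / (4 * (N : ℝ) ^ 2)) ^ k -
      Real.Gamma (a + 1) * (besselCoeff a k * (x * t) ^ k) =
      Real.Gamma (a + 1) * besselCoeff a k * x ^ k * (eigenvalueProd a b N j k - t ^ k) := by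
    rw [jacobiCoeff_mul_pow ha, mul_pow]; ring
  have hk : (k : ℝ) ^ 3 ≤ 8 ^ k := by
    have : (k : ℝ) ≤ 2 ^ k := by exact_mod_cast Nat.lt_two_pow_self.le
    calc (k : ℝ) ^ 3 ≤ (2 ^ k) ^ 3 := by gcongr
      _ = 8 ^ k := by rw [← pow_mul, mul_comm, pow_mul]; norm_num
  rw [e, Real.norm_eq_abs, abs_mul, abs_mul, abs_mul, abs_of_pos hG, abs_pow, abs_of_nonneg hx.1]
  calc _ ≤ Real.Gamma (a + 1) * (c * ((1 / 4) ^ k / k.factorial)) * M ^ k *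
        (T ^ (k + 1) * k ^ 3 / (N : ℝ) ^ 2) := by
        gcongr
        · exact pow_nonneg hx.1 k
        · exact h k
        · exact hx.1
        · exact hx.2
        · exact abs_eigenvalueProd_sub_pow_le ha hb hN hj k
    _ ≤ Real.Gamma (a + 1) * (c * ((1 / 4) ^ k / k.factorial)) * M ^ k *
        (T ^ (k + 1) * 8 ^ k / (N : ℝ) ^ 2) := by gcongr
    _ = _ := by
        rw [show (2 * M * T) ^ k = (1 / 4) ^ k * M ^ k * T ^ k * 8 ^ k by
          rw [← mul_pow, ← mul_pow, ← mul_pow]; ring_nf]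
        ring

/-! ### Convergence of the rescaled sum -/

lemma exists_besselEntire_bounds {a : ℝ} (ha : -1 < a) (R : ℝ) :
    ∃ F : ℝ, 0 ≤ F ∧ (∀ u ∈ Icc 0 R, |besselEntire a u| ≤ F) ∧
      ∀ u ∈ Icc 0 R, ∀ v ∈ Icc 0 R, |besselEntire a u - besselEntire a v| ≤ F * |u - v| := by
  obtain ⟨A, hA⟩ := (isCompact_Icc (a := (0 : ℝ)) (b := R)).exists_bound_of_continuousOn
    (continuous_besselEntire ha).continuousOn
  obtain ⟨B, hB⟩ := (isCompact_Icc (a := (0 : ℝ)) (b := R)).exists_bound_of_continuousOn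
    (((continuous_besselEntire (by linarith : -1 < a + 1)).const_mul (-1 / 4)).continuousOn)
  refine ⟨max 0 (max A B), le_max_left _ _, fun u hu =>
    (hA u hu).trans ((le_max_left _ _).trans (le_max_right _ _)), fun u hu v hv => ?_⟩
  exact Convex.norm_image_sub_le_of_norm_hasDerivWithin_le
    (fun z _ => (hasDerivAt_besselEntire ha z).hasDerivWithinAt)
    (fun z hz => (hB z hz).trans ((le_max_right _ _).trans (le_max_right _ _)))
    (convex_Icc 0 R) hv hu

lemma abs_mul_sub_mul_le {p q r s A B δ : ℝ} (hp : |p - r| ≤ δ) (hq : |q - s| ≤ δ)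
    (hqA : |q| ≤ A) (hrB : |r| ≤ B) : |p * q - r * s| ≤ δ * A + B * δ := by
  have hδ : 0 ≤ δ := (abs_nonneg _).trans hp
  have hB : 0 ≤ B := (abs_nonneg _).trans hrB
  calc |p * q - r * s| = |(p - r) * q + r * (q - s)| := by congr 1; ring
    _ ≤ |p - r| * |q| + |r| * |q - s| := by
      rw [← abs_mul, ← abs_mul]; exact abs_add_le _ _
    _ ≤ _ := by gcongr

/-- Polynomials are replaced by Bessel series, at a cost `O(1/N)` per term against a total mass of
order `N ^ (2a+2)`; then the sum is replaced by the integral. The bound on the integral itself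
serves to control the sum once the weight factors multiply it. -/
theorem exists_abs_jacobiSum_sub_integral_le {a b : ℝ} (ha : -1 < a) (hb : -1 < b)
    {M : ℝ} (hM : 0 ≤ M) :
    ∃ C : ℝ, 0 ≤ C ∧ ∀ N : ℕ, 1 ≤ N → ∀ x ∈ Icc 0 M, ∀ y ∈ Icc 0 M,
      |∫ t in (0 : ℝ)..1, t ^ a * (besselEntire a (x * t) * besselEntire a (y * t))| ≤ C ∧
      |1 / (N : ℝ) ^ (2 * a + 2) *
          ∑ j ∈ Finset.range N, (jacobiIntegral a b (jacobiPoly a b j * jacobiPoly a b j))⁻¹ *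
            ((jacobiPoly a b j).eval (x / (4 * (N : ℝ) ^ 2)) *
              (jacobiPoly a b j).eval (y / (4 * (N : ℝ) ^ 2))) -
        ∫ t in (0 : ℝ)..1, t ^ a * (besselEntire a (x * t) * besselEntire a (y * t))| ≤ C / N := by
  have ha1 : 0 < a + 1 := by linarith
  have hΓ := Real.Gamma_pos_of_pos ha1
  have hΓ2 := Real.Gamma_pos_of_pos (by linarith : 0 < a + 2)
  have hΓe : Real.Gamma (a + 2) = (a + 1) * Real.Gamma (a + 1) := by
    rw [← Real.Gamma_add_one ha1.ne']; congr 1; ring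
  set Γ := Real.Gamma (a + 1)
  set T := jacobiBound a b
  have hT := one_le_jacobiBound a b
  have hT0 : 0 ≤ T := by linarith
  obtain ⟨F, hF, hF1, hF2⟩ := exists_besselEntire_bounds ha (M * T)
  obtain ⟨C₁, hC₁, h₁⟩ := exists_abs_sum_sub_integral_le ha hb
  obtain ⟨C₂, hC₂, h₂⟩ := exists_abs_jacobiPoly_sub_besselEntire_le ha hb hM
  obtain ⟨C₃, hC₃, h₃⟩ := (isOneAddBigO_christoffelSum ha hb).exists_abs_sub_le isOneAddBigO_one
  set D := C₂ * (Γ * F + C₂) + (Γ * F) * C₂ with hD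
  have hD0 : 0 ≤ D := by positivity
  set C₄ := C₁ * (F * F + 2 * F * F * M) / (a + 1) + D * ((1 + C₃) / (Γ * Real.Gamma (a + 2)))
  have hC₄ : 0 ≤ C₄ := by positivity
  refine ⟨F * F / (a + 1) + C₄, by positivity, fun N hN x hx y hy => ?_⟩
  have hN0 : (0 : ℝ) < N := by exact_mod_cast hN
  have hN1 : (1 : ℝ) ≤ N := by exact_mod_cast hN
  have hp : 0 < (N : ℝ) ^ (2 * a + 2) := Real.rpow_pos_of_pos hN0 _
  have hmem : ∀ {z t : ℝ}, z ∈ Icc 0 M → t ∈ Icc 0 T → z * t ∈ Icc 0 (M * T) := fun hz ht =>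
    ⟨mul_nonneg hz.1 ht.1, mul_le_mul hz.2 ht.2 ht.1 hM⟩
  set g : ℝ → ℝ := fun t => besselEntire a (x * t) * besselEntire a (y * t) with hg
  have hgc : Continuous g := by
    have := continuous_besselEntire ha
    fun_prop
  have hgG : ∀ u ∈ Icc 0 T, |g u| ≤ F * F := fun u hu => by
    rw [hg, abs_mul]
    exact mul_le_mul (hF1 _ (hmem hx hu)) (hF1 _ (hmem hy hu)) (abs_nonneg _) hF
  have hLip : ∀ {z : ℝ}, z ∈ Icc 0 M → ∀ u ∈ Icc 0 T, ∀ v ∈ Icc 0 T,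
      |besselEntire a (z * u) - besselEntire a (z * v)| ≤ F * M * |u - v| := fun hz u hu v hv => by
    refine (hF2 _ (hmem hz hu) _ (hmem hz hv)).trans ?_
    rw [← mul_sub, abs_mul, abs_of_nonneg hz.1, ← mul_assoc]
    gcongr
    exact hz.2
  have hgL : ∀ u ∈ Icc 0 T, ∀ v ∈ Icc 0 T, |g u - g v| ≤ 2 * F * F * M * |u - v| :=
    fun u hu v hv => (abs_mul_sub_mul_le (hLip hx u hu v hv) (hLip hy u hu v hv)
      (hF1 _ (hmem hy hu)) (hF1 _ (hmem hx hv))).trans_eq (by ring)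
  have hI := abs_integral_rpow_mul_le ha le_rfl zero_le_one (B := F * F) (h := g) fun t ht => by
    rw [uIcc_of_le zero_le_one] at ht
    exact hgG t ⟨ht.1, ht.2.trans hT⟩
  rw [Real.one_rpow, Real.zero_rpow ha1.ne', sub_zero, abs_one, mul_one, abs_mul,
    abs_of_pos ha1] at hI
  have hI' := (le_div_iff₀' ha1).2 hI
  have hm := h₁ N hN g (F * F) (2 * F * F * M) hgc (by positivity) hgG hgL
  set c : ℕ → ℝ := fun j => (jacobiIntegral a b (jacobiPoly a b j * jacobiPoly a b j))⁻¹ with hc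
  have hc0 : ∀ j, 0 ≤ c j := fun j => (inv_pos.2 (jacobiIntegral_sq_pos ha hb j)).le
  set q : ℕ → ℝ := fun j => (jacobiPoly a b j).eval (x / (4 * (N : ℝ) ^ 2)) *
    (jacobiPoly a b j).eval (y / (4 * (N : ℝ) ^ 2)) with hq
  set t : ℕ → ℝ := fun j => jacobiEigenvalue a b j / (N : ℝ) ^ 2 with ht
  set I := ∫ t in (0 : ℝ)..1, t ^ a * g t
  have hqg : ∀ j ∈ Finset.range N, |q j - Γ ^ 2 * g (t j)| ≤ D / N := fun j hj => by
    have hjN := (Finset.mem_range.1 hj).le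
    have htj := jacobiEigenvalue_div_mem ha hb hN hjN
    have hr : ∀ {z : ℝ}, z ∈ Icc 0 M → |Γ * besselEntire a (z * t j)| ≤ Γ * F := fun hz => by
      rw [abs_mul, abs_of_pos hΓ]
      exact mul_le_mul_of_nonneg_left (hF1 _ (hmem hz htj)) hΓ.le
    have hle : C₂ / (N : ℝ) ^ 2 ≤ C₂ / N :=
      div_le_div_of_nonneg_left hC₂ hN0 (le_self_pow₀ hN1 two_ne_zero)
    have hle' : C₂ / N ≤ C₂ := div_le_self hC₂ hN1
    have kx := (h₂ N hN j hjN x hx).trans hle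
    have ky := (h₂ N hN j hjN y hy).trans hle
    have kq : |(jacobiPoly a b j).eval (y / (4 * (N : ℝ) ^ 2))| ≤ Γ * F + C₂ := by
      have := abs_sub_abs_le_abs_sub ((jacobiPoly a b j).eval (y / (4 * (N : ℝ) ^ 2)))
        (Γ * besselEntire a (y * t j))
      linarith [hr hy]
    have := abs_mul_sub_mul_le kx ky kq (hr hx)
    calc _ = |q j - Γ * besselEntire a (x * t j) * (Γ * besselEntire a (y * t j))| := by
          simp only [hg]; congr 1; ring
      _ ≤ _ := this
      _ = _ := by rw [hD]; ring
  have hS : 1 / (N : ℝ) ^ (2 * a + 2) * christoffelSum a b N ≤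
      (1 + C₃) / (Γ * Real.Gamma (a + 2)) := by
    have := (abs_le.1 (h₃ N hN)).2
    have h5 : C₃ / N ≤ C₃ := div_le_self hC₃.le hN1
    rw [le_div_iff₀ (by positivity)]
    calc _ = Γ * Real.Gamma (a + 2) * christoffelSum a b N / (N : ℝ) ^ (2 * a + 2) := by ring
      _ ≤ _ := by linarith
  have hA : |1 / (N : ℝ) ^ (2 * a + 2) * ∑ j ∈ Finset.range N, c j * (q j - Γ ^ 2 * g (t j))| ≤
      D * ((1 + C₃) / (Γ * Real.Gamma (a + 2))) / N := by
    rw [abs_mul, abs_of_pos (by positivity)]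
    calc _ ≤ 1 / (N : ℝ) ^ (2 * a + 2) * ∑ j ∈ Finset.range N, c j * (D / N) := by
          refine mul_le_mul_of_nonneg_left ?_ (by positivity)
          refine (Finset.abs_sum_le_sum_abs _ _).trans (Finset.sum_le_sum fun j hj => ?_)
          rw [abs_mul, abs_of_nonneg (hc0 j)]
          exact mul_le_mul_of_nonneg_left (hqg j hj) (hc0 j)
      _ = D / N * (1 / (N : ℝ) ^ (2 * a + 2) * christoffelSum a b N) := by
          rw [← Finset.sum_mul, christoffelSum]; ring
      _ ≤ D / N * ((1 + C₃) / (Γ * Real.Gamma (a + 2))) := by gcongr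
      _ = _ := by ring
  have hB : |1 / (N : ℝ) ^ (2 * a + 2) * ∑ j ∈ Finset.range N, c j * (Γ ^ 2 * g (t j)) - I| ≤
      C₁ * (F * F + 2 * F * F * M) / (a + 1) / N := by
    -- `Γ(a+1) Γ(a+2) = (a+1) Γ(a+1)²` reconciles the two normalizations.
    have e : Γ * Real.Gamma (a + 2) / (N : ℝ) ^ (2 * a + 2) *
        ∑ j ∈ Finset.range N, c j * g (t j) - (a + 1) * I = (a + 1) *
        (1 / (N : ℝ) ^ (2 * a + 2) * ∑ j ∈ Finset.range N, c j * (Γ ^ 2 * g (t j)) - I) := by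
      simp only [mul_left_comm (c _) (Γ ^ 2), ← Finset.mul_sum]
      rw [hΓe]
      ring
    rw [e, abs_mul, abs_of_pos ha1] at hm
    rw [div_right_comm]
    exact (le_div_iff₀' ha1).2 hm
  have hC : 0 ≤ F * F / (a + 1) := by positivity
  refine ⟨hI'.trans (le_add_of_nonneg_right hC₄), ?_⟩
  have e : 1 / (N : ℝ) ^ (2 * a + 2) * ∑ j ∈ Finset.range N, c j * q j - I =
      1 / (N : ℝ) ^ (2 * a + 2) * ∑ j ∈ Finset.range N, c j * (q j - Γ ^ 2 * g (t j)) +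
      (1 / (N : ℝ) ^ (2 * a + 2) * ∑ j ∈ Finset.range N, c j * (Γ ^ 2 * g (t j)) - I) := by
    simp only [mul_sub, Finset.sum_sub_distrib]
    ring
  rw [e]
  refine (abs_add_le _ _).trans ((add_le_add hA hB).trans ?_)
  rw [← add_div]
  refine div_le_div_of_nonneg_right ?_ hN0.le
  rw [add_comm (D * _)]
  exact le_add_of_nonneg_left hC

/-! ### Weight factors and conclusion -/

lemma exists_abs_one_sub_rpow_sub_one_le (p : ℝ) :
    ∃ δ : ℝ, 0 < δ ∧ ∃ C : ℝ, 0 < C ∧ ∀ z : ℝ, |z| < δ → |(1 - z) ^ p - 1| ≤ C * |z| := by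
  have hd : DifferentiableAt ℝ (fun z : ℝ => (1 - z) ^ p) 0 :=
    ((differentiableAt_id).const_sub 1).rpow_const (Or.inl (by simp))
  obtain ⟨C, hC, h⟩ := hd.isBigO_sub.exists_pos
  obtain ⟨δ, hδ, h'⟩ := Metric.eventually_nhds_iff.1 h.bound
  refine ⟨δ, hδ, C, hC, fun z hz => ?_⟩
  simpa using h' (y := z) (by simpa using hz)

/-- The two factors `(1 - ·) ^ (a/2)` contribute `N ^ (-2a)`, which joins the prefactor `N ^ (-2)`;
the powers of `2` reduce to `1/4`. -/
lemma rescaled_kernel_eq {a b : ℝ} (ha : -1 < a) (hb : -1 < b) {N : ℕ} (hN : 1 ≤ N) {x y : ℝ}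
    (hx : 0 < x) (hy : 0 < y) (hxN : x / (4 * (N : ℝ) ^ 2) ≤ 1) (hyN : y / (4 * (N : ℝ) ^ 2) ≤ 1) :
    1 / (2 * (N : ℝ) ^ 2) *
        kernel a b N (1 - x / (2 * (N : ℝ) ^ 2)) (1 - y / (2 * (N : ℝ) ^ 2)) =
      (√x / 2) ^ a * (√y / 2) ^ a / 4 *
        ((1 - x / (4 * (N : ℝ) ^ 2)) ^ (b / 2) * (1 - y / (4 * (N : ℝ) ^ 2)) ^ (b / 2) *
        (1 / (N : ℝ) ^ (2 * a + 2) *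
          ∑ j ∈ Finset.range N, (jacobiIntegral a b (jacobiPoly a b j * jacobiPoly a b j))⁻¹ *
            ((jacobiPoly a b j).eval (x / (4 * (N : ℝ) ^ 2)) *
              (jacobiPoly a b j).eval (y / (4 * (N : ℝ) ^ 2))))) := by
  have hN0 : (0 : ℝ) < N := by exact_mod_cast hN
  have hw : ∀ {z : ℝ}, 0 < z → z / (4 * (N : ℝ) ^ 2) ≤ 1 →
      (1 - (1 - z / (2 * (N : ℝ) ^ 2))) ^ (a / 2) * (1 + (1 - z / (2 * (N : ℝ) ^ 2))) ^ (b / 2) =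
        2 ^ ((a + b) / 2) * ((√z / 2) ^ a * ((N : ℝ) ^ a)⁻¹ *
          (1 - z / (4 * (N : ℝ) ^ 2)) ^ (b / 2)) := fun {z} hz hzN => by
    have hsz := Real.sqrt_pos.2 hz
    have e1 : 1 - (1 - z / (2 * (N : ℝ) ^ 2)) = 2 * ((√z / 2) / N) ^ 2 := by
      rw [div_pow, div_pow, Real.sq_sqrt hz.le]; field_simp; norm_num
    have e2 : 1 + (1 - z / (2 * (N : ℝ) ^ 2)) = 2 * (1 - z / (4 * (N : ℝ) ^ 2)) := by
      field_simp; ring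
    rw [e1, e2, Real.mul_rpow zero_le_two (by positivity),
      Real.mul_rpow zero_le_two (by linarith), ← Real.rpow_natCast_mul (by positivity),
      show ((2 : ℕ) : ℝ) * (a / 2) = a by push_cast; ring,
      Real.div_rpow (by positivity) hN0.le, show (a + b) / 2 = a / 2 + b / 2 by ring,
      Real.rpow_add two_pos]
    ring
  have hu : ∀ z : ℝ, (1 - (1 - z / (2 * (N : ℝ) ^ 2))) / 2 = z / (4 * (N : ℝ) ^ 2) := fun z => by
    field_simp; norm_num
  have h2 : (2 : ℝ) ^ ((a + b) / 2) * 2 ^ ((a + b) / 2) = 2 ^ (a + b) := by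
    rw [← Real.rpow_add two_pos]; congr 1; ring
  have hNp : (N : ℝ) ^ (2 * a + 2) = N ^ a * N ^ a * N ^ 2 := by
    rw [← Real.rpow_natCast, ← Real.rpow_add hN0, ← Real.rpow_add hN0]
    congr 1; push_cast; ring
  rw [kernel_eq_sum_jacobiPoly ha hb, hw hx hxN, hw hy hyN, hu, hu,
    Real.rpow_add_one two_ne_zero, ← h2, hNp]
  have hp := (Real.rpow_pos_of_pos two_pos ((a + b) / 2)).ne'
  have hNa := (Real.rpow_pos_of_pos hN0 a).ne'
  generalize (2 : ℝ) ^ ((a + b) / 2) = P at *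
  generalize (N : ℝ) ^ a = Q at *
  field_simp
  norm_num

end JUE

theorem mainTheorem6 (a b : ℝ) (ha : -1 < a) (hb : -1 < b)
    (K : Set ℝ) (hK : IsCompact K) (hKpos : K ⊆ Set.Ioi (0 : ℝ)) :
    ∃ (C : ℝ) (N₀ : ℕ), ∀ N : ℕ, N₀ ≤ N → ∀ x ∈ K, ∀ y ∈ K,
      |1 / (2 * (N : ℝ) ^ 2) *
            JUE.kernel a b N (1 - x / (2 * (N : ℝ) ^ 2)) (1 - y / (2 * (N : ℝ) ^ 2)) -
          JUE.besselKernel a x y| ≤ C / N := by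
  obtain ⟨M, hM⟩ := hK.exists_bound_of_continuousOn continuousOn_id
  -- For negative `a` this bound relies on `K` staying away from `0`.
  obtain ⟨W, hW⟩ := hK.exists_bound_of_continuousOn (f := fun x : ℝ => (√x / 2) ^ a)
    fun x hx => ContinuousAt.continuousWithinAt
      ((Real.continuous_sqrt.continuousAt.div_const 2).rpow_const
        (Or.inl (by have := Real.sqrt_pos.2 (hKpos hx); positivity)))
  rcases K.eq_empty_or_nonempty with rfl | ⟨x₀, hx₀⟩
  · exact ⟨0, 0, by simp⟩
  have hM0 : 0 ≤ M := (norm_nonneg _).trans (hM x₀ hx₀)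
  have hW0 : 0 ≤ W := (norm_nonneg _).trans (hW x₀ hx₀)
  have hKM : ∀ x ∈ K, x ∈ Set.Icc 0 M := fun x hx =>
    ⟨(hKpos hx).le, (le_abs_self x).trans (hM x hx)⟩
  obtain ⟨C, hC, h⟩ := JUE.exists_abs_jacobiSum_sub_integral_le ha hb hM0
  obtain ⟨δ, hδ, c, hc, hβ⟩ := JUE.exists_abs_one_sub_rpow_sub_one_le (b / 2)
  -- For `N > N₁`, the ratio `M / N` is below `δ`, where the expansion of the weight holds, and
  -- below `1`, which keeps the bases of the powers nonnegative.
  obtain ⟨N₁, hN₁⟩ := exists_nat_gt (M / min δ 1)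
  -- The factor `2 * C` bounds the rescaled sum: the integral is at most `C`, and the error `C / N`
  -- is at most `C`.
  refine ⟨W * W / 4 * ((c * M * (1 + c * M) + 1 * (c * M)) * (2 * C) + 1 * C), N₁ + 1,
    fun N hN x hx y hy => ?_⟩
  have hN0 : 1 ≤ N := by omega
  have hNp : (1 : ℝ) ≤ N := by exact_mod_cast hN0
  have hNp0 : (0 : ℝ) < N := by linarith
  have hNM : M / N < min δ 1 := by
    have : (N₁ : ℝ) ≤ N := by exact_mod_cast (by omega : N₁ ≤ N)
    rw [div_lt_iff₀ hNp0, mul_comm, ← div_lt_iff₀ (lt_min hδ one_pos)]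
    linarith
  have hu : ∀ z ∈ K, 0 ≤ z / (4 * (N : ℝ) ^ 2) ∧ z / (4 * (N : ℝ) ^ 2) ≤ M / N := fun z hz => by
    have := hKM z hz
    refine ⟨div_nonneg this.1 (by positivity), div_le_div₀ hM0 this.2 hNp0 ?_⟩
    nlinarith
  have hβ' : ∀ z ∈ K, |(1 - z / (4 * (N : ℝ) ^ 2)) ^ (b / 2) - 1| ≤ c * M / N := fun z hz => by
    have hz' := hu z hz
    have e := abs_of_nonneg hz'.1
    refine (hβ _ (by rw [e]; exact hz'.2.trans_lt (hNM.trans_le (min_le_left _ _)))).trans ?_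
    rw [e, mul_div_assoc]
    exact mul_le_mul_of_nonneg_left hz'.2 hc.le
  have hle1 : ∀ z ∈ K, z / (4 * (N : ℝ) ^ 2) ≤ 1 := fun z hz =>
    (hu z hz).2.trans (hNM.trans_le (min_le_right _ _)).le
  obtain ⟨hI, hR⟩ := h N hN0 x (hKM x hx) y (hKM y hy)
  rw [JUE.rescaled_kernel_eq ha hb hN0 (hKpos hx) (hKpos hy) (hle1 x hx) (hle1 y hy),
    JUE.besselKernel_eq_integral ha (hKpos hx) (hKpos hy), ← mul_sub]
  set I := ∫ t in (0 : ℝ)..1, t ^ a * (JUE.besselEntire a (x * t) * JUE.besselEntire a (y * t))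
  set R := 1 / (N : ℝ) ^ (2 * a + 2) * ∑ j ∈ Finset.range N,
    (JUE.jacobiIntegral a b (JUE.jacobiPoly a b j * JUE.jacobiPoly a b j))⁻¹ *
      ((JUE.jacobiPoly a b j).eval (x / (4 * (N : ℝ) ^ 2)) *
        (JUE.jacobiPoly a b j).eval (y / (4 * (N : ℝ) ^ 2)))
  have bx := hβ' x hx
  have bY := hβ' y hy
  set p := (1 - x / (4 * (N : ℝ) ^ 2)) ^ (b / 2)
  set q := (1 - y / (4 * (N : ℝ) ^ 2)) ^ (b / 2)
  have hcM : c * M / N ≤ c * M := div_le_self (by positivity) hNp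
  have hq : |q| ≤ 1 + c * M := by
    have := abs_sub_abs_le_abs_sub q 1
    rw [abs_one] at this
    linarith
  have hRC : |R| ≤ 2 * C := by
    have := abs_sub_abs_le_abs_sub R I
    have : C / N ≤ C := div_le_self hC hNp
    linarith
  have hpq := JUE.abs_mul_sub_mul_le bx bY hq abs_one.le
  have hmain : |p * q * R - I| ≤
      ((c * M * (1 + c * M) + 1 * (c * M)) * (2 * C) + 1 * C) / N := by
    calc |p * q * R - I| = |(p * q - 1 * 1) * R + (R - I)| := by congr 1; ring
      _ ≤ |p * q - 1 * 1| * |R| + |R - I| := by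
        rw [← abs_mul]; exact abs_add_le _ _
      _ ≤ (c * M / N * (1 + c * M) + 1 * (c * M / N)) * (2 * C) + C / N := by gcongr
      _ = _ := by ring
  have hWW : |(√x / 2) ^ a * (√y / 2) ^ a / 4| ≤ W * W / 4 := by
    rw [abs_div, abs_mul, abs_of_pos (four_pos : (0 : ℝ) < 4)]
    gcongr
    · exact hW x hx
    · exact hW y hy
  rw [abs_mul, mul_div_assoc (W * W / 4)]
  exact mul_le_mul hWW hmain (abs_nonneg _) (by positivity)
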